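/- **Setting.** Let $G=(V,E)$ be a finite simple bipartite graph with colour classes $F$ and $W$, positive real capacities $b(e)$ $(e\in E)$, positive real quotas $q(v)$ $(v\in V)$, and for each $v\in V$ a weak linear order (total preorder) $\ge_v$ on the set $E_v$ of edges incident to $v$; its equivalence classes are the *ties* of $v$. Put $|z|=\sum_{e\in E_v}z(e)$ and let $\mathcal B_v=\{z\in\mathbb R^{E_v}: 0\le z\le b\}$. The choice function $C_v:\mathcal B_v\to\mathcal B_v$ is: $C_v(z)=z$ if $|z|\le q(v)$; otherwise let the *critical* tie $\pi$ be the tie for which the sum of $z$ over the strictly better ties is $<q(v)$ while adding $z(\pi)$ makes it $\ge q(v)$; $C_v(z)$ equals $z$ on better ties, $0$ on worse ties, and $\min(r,z(e))$ for $e\in\pi$, with $r$ such that $|C_v(z)|=q(v)$. Write $z\succeq_v z'$ if $C_v(z\vee z')=z$. An assignment $x:E\to\mathbb R$ is *fully stationary* if for every $v$ its restriction $x_v$ to $E_v$ lies in $\mathcal B_v$ and $C_v(x_v)=x_v$. An edge $e\in E_v$ is *interesting* for $v$ under $x$ if some $z\in\mathcal B_v$ that agrees with $x_v$ off $e$ satisfies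 $z(e)>x(e)$ and $C_v(z)(e)>x(e)$. A fully stationary $x$ is *stable* if no edge is interesting for both of its ends. Let $\mathcal S$ be the set of stable assignments, write $x\succeq_W y$ if $x_w\succeq_w y_w$ for all $w\in W$, and let $x^{\min}$ be the minimum of $(\mathcal S,\succeq_W)$ (the best stable assignment for $F$ and the worst for $W$). **Active graph.** Let $x\in\mathcal S$. A vertex $v$ is *fully filled* if $|x_v|=q(v)$, otherwise *deficit*. For a fully filled $v$, the head $H_v$ is the set of edges of the critical tie (defined as above with $z=x_v$) at which $x$ attains its maximum over that tie, and the tail $T_v$ is the set of the other edges in the critical or better ties; for a deficit $v$, $H_v=\emptyset$ and $T_v=E_v$. An edge $e$ is *unsaturated* if $x(e)<b(e)$. For a fully filled $f\in F$ consider the ties $\pi$ of $f$ such that (a) the set $D(\pi)$ of unsaturated edges $fw\in\pi$ with $fw\in T_w$ is nonempty, and (b) no tie of $f$ better than or equal to $\pi$ contains an unsaturated edge incident to a deficit vertex of $W$; put $D_f=D(\pi)$ for the best such $\pi$, and $D_f=\emptyset$ if there is none. Let $V^0$ be the smallest set of fully filled vertices that contains every fully filled $w\in W$ whose head $H_w$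 has an edge to a deficit vertex, every fully filled $f\in F$ with $D_f=\emptyset$, and every fully filled vertex whose head ($H_w$ or $D_f$, respectively) has an edge to a vertex of $V^0$. Fully filled vertices not in $V^0$ are *regular*; $F^+,W^+$ are the sets of regular vertices in $F,W$. The directed active graph $\vec\Gamma(x)$ has an arc $(f,w)$ for each $f\in F^+$, $fw\in D_f$, and an arc $(w,f)$ for each $w\in W^+$, $fw\in H_w$. A strong component is a maximal vertex set of more than one vertex, any two of which are mutually reachable; it is *maximal* if no other strong component is reachable from it. Let $\mathcal L(x)$ be the set of maximal strong components. **Rotations and shifts.** For $L\in\mathcal L(x)$ let $(\phi,\psi)\in\mathbb R_{\ge0}^{F^+}\times\mathbb R_{\ge0}^{W^+}$ be nonzero, vanish outside $L$, and satisfy $$|D_f|\,\phi_f=\sum_{w\in W^+:\ fw\in H_w}\psi_w\quad(f\in F^+),\qquad |H_w|\,\psi_w=\sum_{f\in F^+:\ fw\in D_f}\phi_f\quad(w\in W^+);$$ it is unique up to a positive factor. Let $\Delta(fw)=\phi_f$ if $f\in F^+$ and $fw\in D_f$, $\Delta(fw)=-\psi_w$ if $w\in W^+$ and $fw\in H_w$,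 and $\Delta=0$ on all other edges. The *rotation* $\rho_L$ is the integer vector with greatest common divisor of its entries equal to $1$ that is a positive multiple of $\Delta$. (It is a nonzero circulation, i.e. $\sum_{e\in E_v}\rho_L(e)=0$ for all $v$, and is aligned: its positive values at edges sharing a vertex of $F$ coincide, and so do its negative values at edges sharing a vertex of $W$.) A number $\lambda\ge0$ is *admissible* for $\rho_L$ under $x$ if $x'=x+\lambda\rho_L$ satisfies $0\le x'\le b$ and for each $w\in W^+$ either $x'$ and $x$ have the same critical tie at $w$ and $H_w(x')\supseteq H_w(x)$, or $x'$ is zero on the critical tie of $x$ at $w$. For an admissible $\lambda>0$, passing from $x$ to $x+\lambda\rho_L$ is a *rotational shift*; it is *full* if $\lambda$ is the largest admissible number. **Lemma.** (i) If $x_0,x_1,\dots,x_N$ are such that $x_0$ is stable and each $x_i$ $(1\le i\le N)$ is obtained from $x_{i-1}$ by a full rotational shift, then $N\le 2|E|$. (ii) Every $y\in\mathcal S$ can be obtained from $x^{\min}$ by a sequence of at most $2|E|$ rotational shifts, all of whose members are stable assignments. -/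

import Mathlib

/-- An instance of the stable assignment problem of mixed type: a finite simple bipartite graph with
colour classes `F` (firms) and `W` (workers) and edge set `E`, positive capacities on the edges,
positive quotas on the vertices, and for each vertex a weak linear order on its incident edges. -/
structure MixedProblem (F W E : Type*) where
  fend : E → F
  wend : E → W
  simple : ∀ e e' : E, fend e = fend e' → wend e = wend e' → e = e'
  b : E → ℝ
  b_pos : ∀ e, 0 < b e
  q : F ⊕ W → ℝ
  q_pos : ∀ v, 0 < q v
  /-- `ge v e e'`: the vertex `v` weakly prefers `e` to `e'` (only used for edges at `v`). -/
  ge : F ⊕ W → E → E → Prop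
  ge_total : ∀ v e e', (Sum.elim (fun f => fend e = f) (fun w => wend e = w) v) →
    (Sum.elim (fun f => fend e' = f) (fun w => wend e' = w) v) → ge v e e' ∨ ge v e' e
  ge_trans : ∀ v e e' e'', (Sum.elim (fun f => fend e = f) (fun w => wend e = w) v) →
    (Sum.elim (fun f => fend e' = f) (fun w => wend e' = w) v) →
    (Sum.elim (fun f => fend e'' = f) (fun w => wend e'' = w) v) →
    ge v e e' → ge v e' e'' → ge v e e''

namespace MixedProblem

variable {F W E : Type*} [Fintype F] [Fintype W] [Fintype E] (P : MixedProblem F W E)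

/-! ### Edges at a vertex, ties and partial sums -/

open scoped Classical in
/-- The set `E_v` of edges incident to `v`. -/
noncomputable def edges (v : F ⊕ W) : Finset E :=
  Finset.univ.filter fun e => Sum.elim (fun f => P.fend e = f) (fun w => P.wend e = w) v

/-- Strict preference `e >_v e'`. -/
def gt (v : F ⊕ W) (e e' : E) : Prop := P.ge v e e' ∧ ¬ P.ge v e' e

/-- Equivalence `e ∼_v e'`, that is, `e` and `e'` lie in the same tie of `v`. -/
def equiv (v : F ⊕ W) (e e' : E) : Prop := P.ge v e e' ∧ P.ge v e' e

/-- `|z_v|`, the total value at `v`. -/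
noncomputable def total (v : F ⊕ W) (z : E → ℝ) : ℝ := ∑ e ∈ P.edges v, z e

open scoped Classical in
/-- The sum of `z` over all ties of `v` strictly better than the tie of `e`. -/
noncomputable def sumBetter (v : F ⊕ W) (z : E → ℝ) (e : E) : ℝ :=
  ∑ e' ∈ (P.edges v).filter (fun e' => P.gt v e' e), z e'

open scoped Classical in
/-- The sum of `z` over all ties of `v` better than or equal to the tie of `e`. -/
noncomputable def sumBetterEq (v : F ⊕ W) (z : E → ℝ) (e : E) : ℝ :=
  ∑ e' ∈ (P.edges v).filter (fun e' => P.ge v e' e), z e'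

/-! ### Choice functions of mixed type -/

open scoped Classical in
/-- A cutting height `r` for the tie of `e` at `v` under `z`: a number such that the sum of `z` over
the strictly better ties plus the sum of `min r z` over the tie of `e` is `q v`. -/
noncomputable def cutHeight (v : F ⊕ W) (z : E → ℝ) (e : E) : ℝ :=
  Classical.epsilon fun r : ℝ =>
    P.sumBetter v z e + ∑ e' ∈ (P.edges v).filter (fun e' => P.equiv v e' e), min r (z e') = P.q v

open scoped Classical in
/-- The choice function `C_v` of mixed type, evaluated at the edge `e` of `E_v`: if `|z_v| ≤ q v`
nothing changes; otherwise ties later than the critical one become zero, ties earlier than the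
critical one are preserved, and the critical tie is cut at the cutting height. -/
noncomputable def choice (v : F ⊕ W) (z : E → ℝ) (e : E) : ℝ :=
  if P.total v z ≤ P.q v then z e
  else if P.q v ≤ P.sumBetter v z e then 0
  else if P.sumBetterEq v z e < P.q v then z e
  else min (P.cutHeight v z e) (z e)

/-- Membership of (the restriction to `E_v` of) `z` in the box `B_v`. -/
def InBox (v : F ⊕ W) (z : E → ℝ) : Prop := ∀ e ∈ P.edges v, 0 ≤ z e ∧ z e ≤ P.b e

/-- The revealed preference `x_v ⪰_v y_v`, that is, `C_v (x_v ∨ y_v) = x_v`. -/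
def Prefers (v : F ⊕ W) (x y : E → ℝ) : Prop :=
  ∀ e ∈ P.edges v, P.choice v (fun a => max (x a) (y a)) e = x e

/-- `x ⪰_W y`. -/
def PrefersW (x y : E → ℝ) : Prop := ∀ w : W, P.Prefers (Sum.inr w) x y

/-! ### Stable assignments -/

/-- Fully stationary assignments: `0 ≤ x ≤ b` and `C_v (x_v) = x_v` for all vertices `v`. -/
def Stationary (x : E → ℝ) : Prop :=
  ∀ v, P.InBox v x ∧ ∀ e ∈ P.edges v, P.choice v x e = x e

/-- The edge `e` of `E_v` is interesting for `v` under `x`. -/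
def Interesting (v : F ⊕ W) (x : E → ℝ) (e : E) : Prop :=
  ∃ z : E → ℝ, P.InBox v z ∧ x e < z e ∧ (∀ e' ∈ P.edges v, e' ≠ e → z e' = x e') ∧
    x e < P.choice v z e

/-- The edge `e` is blocking for `x`. -/
def Blocking (x : E → ℝ) (e : E) : Prop :=
  P.Interesting (Sum.inl (P.fend e)) x e ∧ P.Interesting (Sum.inr (P.wend e)) x e

/-- Stable assignments. -/
def Stable (x : E → ℝ) : Prop := P.Stationary x ∧ ∀ e, ¬ P.Blocking x e

/-- `x` is the minimum of the set of stable assignments ordered by `⪰_W`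
(the worst for `W` and the best for `F`). -/
def IsXmin (x : E → ℝ) : Prop := P.Stable x ∧ ∀ y, P.Stable y → P.PrefersW y x

/-! ### Critical ties, heads and tails -/

/-- `v` is fully filled by `x`. -/
def Filled (x : E → ℝ) (v : F ⊕ W) : Prop := P.total v x = P.q v

open scoped Classical in
/-- The critical tie at `v` (for `v` fully filled by `x`). -/
noncomputable def critTie (x : E → ℝ) (v : F ⊕ W) : Finset E :=
  (P.edges v).filter fun e => P.sumBetter v x e < P.q v ∧ P.q v ≤ P.sumBetterEq v x e

open scoped Classical in
/-- The edges in the ties better than the critical one (for `v` fully filled by `x`). -/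
noncomputable def beg (x : E → ℝ) (v : F ⊕ W) : Finset E :=
  (P.edges v).filter fun e => P.sumBetterEq v x e < P.q v

open scoped Classical in
/-- The head `H_v(x)`: the edges of the critical tie at which `x` attains its maximum over this tie
(the cutting height of a quota filling assignment); empty if `v` is deficit. -/
noncomputable def head (x : E → ℝ) (v : F ⊕ W) : Finset E :=
  if P.Filled x v then (P.critTie x v).filter fun e => ∀ e' ∈ P.critTie x v, x e' ≤ x e else ∅

open scoped Classical in
/-- The tail `T_v(x)`; it is all of `E_v` if `v` is deficit. -/
noncomputable def tail (x : E → ℝ) (v : F ⊕ W) : Finset E :=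
  if P.Filled x v then P.beg x v ∪ (P.critTie x v \ P.head x v) else P.edges v

/-! ### Potential heads and the cleaning procedure -/

/-- `e = fw` is unsaturated and belongs to the tail at its end `w`. -/
def Candidate (x : E → ℝ) (e : E) : Prop :=
  x e < P.b e ∧ e ∈ P.tail x (Sum.inr (P.wend e))

/-- No tie of `f` better than or equal to the tie of `e` contains an unsaturated edge incident to a
deficit vertex in `W`. -/
def NoDeficitBefore (x : E → ℝ) (f : F) (e : E) : Prop :=
  ∀ e' ∈ P.edges (Sum.inl f), P.ge (Sum.inl f) e' e → x e' < P.b e' →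
    P.Filled x (Sum.inr (P.wend e'))

open scoped Classical in
/-- The edges of `E_f` lying in the sets `D^i_f(x)` for the ties `π^i` in `\hat Π_f(x)`. -/
noncomputable def potential (x : E → ℝ) (f : F) : Finset E :=
  (P.edges (Sum.inl f)).filter fun e => P.Candidate x e ∧ P.NoDeficitBefore x f e

open scoped Classical in
/-- The potential head `D_f(x)`: the part of `potential x f` in the best possible tie. -/
noncomputable def potHead (x : E → ℝ) (f : F) : Finset E :=
  if P.Filled x (Sum.inl f) then
    (P.potential x f).filter fun e => ∀ e' ∈ P.potential x f, P.ge (Sum.inl f) e e'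
  else ∅

/-- The fully filled vertices inserted in `V^0` by the cleaning procedure. -/
inductive Singular (x : E → ℝ) : F ⊕ W → Prop
  | deficitHead (w : W) (e : E) : P.Filled x (Sum.inr w) → e ∈ P.head x (Sum.inr w) →
      ¬ P.Filled x (Sum.inl (P.fend e)) → Singular x (Sum.inr w)
  | emptyHead (f : F) : P.Filled x (Sum.inl f) → P.potHead x f = ∅ → Singular x (Sum.inl f)
  | stepW (w : W) (e : E) : P.Filled x (Sum.inr w) → e ∈ P.head x (Sum.inr w) →
      Singular x (Sum.inl (P.fend e)) → Singular x (Sum.inr w)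
  | stepF (f : F) (e : E) : P.Filled x (Sum.inl f) → e ∈ P.potHead x f →
      Singular x (Sum.inr (P.wend e)) → Singular x (Sum.inl f)

/-- Regular vertices: fully filled and not singular. -/
def Regular (x : E → ℝ) (v : F ⊕ W) : Prop := P.Filled x v ∧ ¬ P.Singular x v

/-! ### The active graph and its maximal strong components -/

/-- `e` is active for `F`. -/
def ActiveF (x : E → ℝ) (e : E) : Prop :=
  P.Regular x (Sum.inl (P.fend e)) ∧ e ∈ P.potHead x (P.fend e)

/-- `e` is active for `W`. -/
def ActiveW (x : E → ℝ) (e : E) : Prop :=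
  P.Regular x (Sum.inr (P.wend e)) ∧ e ∈ P.head x (Sum.inr (P.wend e))

/-- The arcs of the directed active graph. -/
inductive Arc (x : E → ℝ) : F ⊕ W → F ⊕ W → Prop
  | ofF (e : E) : P.ActiveF x e → Arc x (Sum.inl (P.fend e)) (Sum.inr (P.wend e))
  | ofW (e : E) : P.ActiveW x e → Arc x (Sum.inr (P.wend e)) (Sum.inl (P.fend e))

/-- Reachability by directed paths in the directed active graph. -/
def Reach (x : E → ℝ) : F ⊕ W → F ⊕ W → Prop := Relation.ReflTransGen (P.Arc x)

/-- `L` is (the vertex set of) a strong component of the directed active graph. -/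
def IsStrongComponent (x : E → ℝ) (L : Set (F ⊕ W)) : Prop :=
  Maximal (fun S : Set (F ⊕ W) => S.Nontrivial ∧ ∀ u ∈ S, ∀ v ∈ S, P.Reach x u v) L

/-- `L` is a maximal strong component: no other strong component is reachable from it. -/
def IsMaxComponent (x : E → ℝ) (L : Set (F ⊕ W)) : Prop :=
  P.IsStrongComponent x L ∧
    ∀ L', P.IsStrongComponent x L' → (∃ u ∈ L, ∃ v ∈ L', P.Reach x u v) → L' = L

/-! ### Rotations -/

open scoped Classical in
/-- The linear system for `(φ, ψ)`: balance at the regular firms and workers, normalization to `ε`,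
and nonnegativity. -/
structure IsSolution (x : E → ℝ) (ε : ℝ) (φ : F → ℝ) (ψ : W → ℝ) : Prop where
  balanceF : ∀ f, P.Regular x (Sum.inl f) →
    ((P.potHead x f).card : ℝ) * φ f
      - ∑ e ∈ (P.edges (Sum.inl f)).filter (fun e => P.ActiveW x e), ψ (P.wend e) = 0
  balanceW : ∀ w, P.Regular x (Sum.inr w) →
    ((P.head x (Sum.inr w)).card : ℝ) * ψ w
      - ∑ e ∈ (P.edges (Sum.inr w)).filter (fun e => P.ActiveF x e), φ (P.fend e) = 0
  sum_eq :
    ∑ f ∈ Finset.univ.filter (fun f => P.Regular x (Sum.inl f)), ((P.potHead x f).card : ℝ) * φ f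
      + ∑ w ∈ Finset.univ.filter (fun w => P.Regular x (Sum.inr w)),
          ((P.head x (Sum.inr w)).card : ℝ) * ψ w = ε
  nonnegF : ∀ f, P.Regular x (Sum.inl f) → 0 ≤ φ f
  nonnegW : ∀ w, P.Regular x (Sum.inr w) → 0 ≤ ψ w

open scoped Classical in
/-- The vector `Δ^{φ,ψ}` on the edges. -/
noncomputable def delta (x : E → ℝ) (φ : F → ℝ) (ψ : W → ℝ) (e : E) : ℝ :=
  if P.ActiveF x e then φ (P.fend e) else if P.ActiveW x e then - ψ (P.wend e) else 0

/-- Nonzero integer circulations. -/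
def IsCirculation (ρ : E → ℤ) : Prop := ρ ≠ 0 ∧ ∀ v, ∑ e ∈ P.edges v, ρ e = 0

/-- Aligned integer functions on the edges. -/
def IsAligned (ρ : E → ℤ) : Prop :=
  (∀ e e', P.fend e = P.fend e' → 0 < ρ e → 0 < ρ e' → ρ e = ρ e') ∧
  (∀ e e', P.wend e = P.wend e' → ρ e < 0 → ρ e' < 0 → ρ e = ρ e')

/-- `ρ` is the rotation for `x` associated with `L`: the normalized aligned integer circulation that
is a positive multiple of `Δ^{φ,ψ}`, where `(φ, ψ)` solves the system and vanishes outside `L`. -/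
def IsRotation (x : E → ℝ) (L : Set (F ⊕ W)) (ρ : E → ℤ) : Prop :=
  P.IsCirculation ρ ∧ P.IsAligned ρ ∧ Finset.univ.gcd ρ = 1 ∧
    ∃ (ε : ℝ) (φ : F → ℝ) (ψ : W → ℝ), 0 < ε ∧ P.IsSolution x ε φ ψ ∧
      (∀ f, Sum.inl f ∉ L → φ f = 0) ∧ (∀ w, Sum.inr w ∉ L → ψ w = 0) ∧
      ∃ c : ℝ, 0 < c ∧ ∀ e, (ρ e : ℝ) = c * P.delta x φ ψ e

/-- The result of applying to `x` the shift of weight `t` along `ρ`. -/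
def shift (x : E → ℝ) (t : ℝ) (ρ : E → ℤ) : E → ℝ := fun e => x e + t * (ρ e : ℝ)

/-- The weight `t` is admissible for the rotation `ρ` under `x`. -/
def Admissible (x : E → ℝ) (ρ : E → ℤ) (t : ℝ) : Prop :=
  0 ≤ t ∧ (∀ e, 0 ≤ shift x t ρ e ∧ shift x t ρ e ≤ P.b e) ∧
    ∀ w : W, P.Regular x (Sum.inr w) →
      (P.critTie (shift x t ρ) (Sum.inr w) = P.critTie x (Sum.inr w) ∧
        P.head x (Sum.inr w) ⊆ P.head (shift x t ρ) (Sum.inr w)) ∨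
      ∀ e ∈ P.critTie x (Sum.inr w), shift x t ρ e = 0

/-- `y` is obtained from `x` by a rotational shift (of positive admissible weight). -/
def IsRotShift (x y : E → ℝ) : Prop :=
  ∃ (L : Set (F ⊕ W)) (ρ : E → ℤ) (t : ℝ), P.IsMaxComponent x L ∧ P.IsRotation x L ρ ∧
    0 < t ∧ P.Admissible x ρ t ∧ y = shift x t ρ

/-- `y` is obtained from `x` by a full rotational shift, that is, one whose weight is the maximal
admissible weight. -/
def IsFullRotShift (x y : E → ℝ) : Prop :=
  ∃ (L : Set (F ⊕ W)) (ρ : E → ℤ) (t : ℝ), P.IsMaxComponent x L ∧ P.IsRotation x L ρ ∧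
    IsGreatest {s : ℝ | P.Admissible x ρ s} t ∧ y = shift x t ρ

end MixedProblem

namespace MixedProblem

variable {F W E : Type*} [Fintype E] (P : MixedProblem F W E)

open scoped Classical

/-! ### Ranks of edges -/

/-! Everything is expressed through tails. An edge is in the tail at a filled vertex exactly when
some edge of the support lies in a worse tie, or in the same tie with a larger value. In these
terms, `y` is preferred to `z` at a vertex iff `z ≤ y` on the tail of `y` (`prefers_iff`), and
stability means capacities, quotas, and no unsaturated edge in the tails of both ends
(`stable_iff`).

The bound `2|E|` is a counting argument. `progress` counts the edges outside the workers' tails,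
plus the edges that are outside those tails or have reached a bound `u`. Along a shift an edge never
re-enters a worker's tail, and an edge that reached the bound while in the tail stays put until it
leaves the tail. Hence both sets only grow. If neither grows, every constraint on the weight is
either strict or an identity, so the weight can be increased (`exists_gt_safeShift`). A shift of
maximal weight therefore gains at least one unit, and the total never exceeds `2|E|`. With `u = b`
the maximal safe weight is the maximal admissible one, which gives (i).

For (ii), let `x` be stable and `y` a stable assignment that all workers weakly prefer. The firms
then prefer `x`, all vertex totals agree, and every vertex where `x` and `y` differ is regular.
These vertices form a set closed under arcs of the active graph: when a worker differs, all of its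
head decreases, and a potential head cannot lead to an unchanged worker. The set therefore contains
a maximal strong component, whose rotation exists because the weighted flow of a closed vertex set
has a nonnegative stationary vector (`exists_stationary_vector`). The shift along it is run with the
bound `y` on the worker tails of `y` and `b` elsewhere (`targetBound`). It stays stable
(`stable_shift`) and below `y` in the workers' order, and it gains progress, so iteration ends at
`y` within `2|E|` shifts. -/

theorem mem_edges {v : F ⊕ W} {e : E} : e ∈ P.edges v ↔
    Sum.elim (fun f => P.fend e = f) (fun w => P.wend e = w) v := by
  simp [edges]

@[simp] theorem mem_edges_inl {f : F} {e : E} : e ∈ P.edges (Sum.inl f) ↔ P.fend e = f :=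
  P.mem_edges

@[simp] theorem mem_edges_inr {w : W} {e : E} : e ∈ P.edges (Sum.inr w) ↔ P.wend e = w :=
  P.mem_edges

/-- The number of edges at `v` that are at least as good as `e`. -/
noncomputable def rank (v : F ⊕ W) (e : E) : ℕ :=
  ((P.edges v).filter fun e' => P.ge v e' e).card

variable {P}

/-- By transitivity the upper sets of edges are nested, and by totality each edge lies in its own,
so their cardinalities encode the preorder. Ties become equalities of natural numbers, which `omega`
can handle. -/
theorem ge_iff {v : F ⊕ W} {e e' : E} (he : e ∈ P.edges v) (he' : e' ∈ P.edges v) :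
    P.ge v e e' ↔ P.rank v e ≤ P.rank v e' := by
  have key : ∀ a ∈ P.edges v, ∀ b ∈ P.edges v, P.ge v a b →
      (P.edges v).filter (fun c => P.ge v c a) ⊆ (P.edges v).filter (fun c => P.ge v c b) := by
    intro a ha b hb hab c hc
    rw [Finset.mem_filter] at hc ⊢
    exact ⟨hc.1, P.ge_trans v c a b (P.mem_edges.1 hc.1) (P.mem_edges.1 ha) (P.mem_edges.1 hb)
      hc.2 hab⟩
  constructor
  · exact fun h => Finset.card_le_card (key e he e' he' h)
  · intro h
    rcases P.ge_total v e e' (P.mem_edges.1 he) (P.mem_edges.1 he') with h1 | h1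
    · exact h1
    · have h2 := Finset.eq_of_subset_of_card_le (key e' he' e he h1) h
      have h3 : e ∈ (P.edges v).filter (fun c => P.ge v c e) := by
        rw [Finset.mem_filter]
        refine ⟨he, ?_⟩
        rcases P.ge_total v e e (P.mem_edges.1 he) (P.mem_edges.1 he) with h | h <;> exact h
      rw [← h2, Finset.mem_filter] at h3
      exact h3.2

theorem gt_iff {v : F ⊕ W} {e e' : E} (he : e ∈ P.edges v) (he' : e' ∈ P.edges v) :
    P.gt v e e' ↔ P.rank v e < P.rank v e' := by
  rw [gt, ge_iff he he', ge_iff he' he]; omega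

theorem equiv_iff {v : F ⊕ W} {e e' : E} (he : e ∈ P.edges v) (he' : e' ∈ P.edges v) :
    P.equiv v e e' ↔ P.rank v e = P.rank v e' := by
  rw [equiv, ge_iff he he', ge_iff he' he]; omega

theorem sumBetter_eq {v : F ⊕ W} {e : E} (he : e ∈ P.edges v) (z : E → ℝ) :
    P.sumBetter v z e = ∑ e' ∈ (P.edges v).filter (fun e' => P.rank v e' < P.rank v e), z e' := by
  unfold sumBetter
  congr 1
  exact Finset.filter_congr fun a ha => gt_iff ha he

theorem sumBetterEq_eq {v : F ⊕ W} {e : E} (he : e ∈ P.edges v) (z : E → ℝ) :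
    P.sumBetterEq v z e = ∑ e' ∈ (P.edges v).filter (fun e' => P.rank v e' ≤ P.rank v e), z e' := by
  unfold sumBetterEq
  congr 1
  exact Finset.filter_congr fun a ha => ge_iff ha he

theorem filter_equiv_eq {v : F ⊕ W} {e : E} (he : e ∈ P.edges v) :
    (P.edges v).filter (fun e' => P.equiv v e' e) =
      (P.edges v).filter (fun e' => P.rank v e' = P.rank v e) :=
  Finset.filter_congr fun _ ha => equiv_iff ha he

/-! ### Critical ties, heads and tails through ranks and supports -/

theorem sum_filter_lt_iff {α : Type*} {s : Finset α} {z : α → ℝ} (hz : ∀ e ∈ s, 0 ≤ z e) (p : α → Prop)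
    [DecidablePred p] :
    ∑ e ∈ s.filter p, z e < ∑ e ∈ s, z e ↔ ∃ e ∈ s, ¬ p e ∧ 0 < z e := by
  rw [← Finset.sum_filter_add_sum_filter_not s p z, lt_add_iff_pos_right,
    Finset.sum_pos_iff_of_nonneg fun e he => hz e (Finset.mem_filter.1 he).1]
  simp only [Finset.mem_filter, and_assoc]

theorem filled_def {x : E → ℝ} {v : F ⊕ W} : P.Filled x v ↔ ∑ e ∈ P.edges v, x e = P.q v := Iff.rfl

theorem sumBetterEq_lt_iff {x : E → ℝ} {v : F ⊕ W} (hx : ∀ e ∈ P.edges v, 0 ≤ x e)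
    (hf : P.Filled x v) {e : E} (he : e ∈ P.edges v) :
    P.sumBetterEq v x e < P.q v ↔ ∃ e' ∈ P.edges v, 0 < x e' ∧ P.rank v e < P.rank v e' := by
  rw [sumBetterEq_eq he, ← filled_def.1 hf, sum_filter_lt_iff hx]
  simp only [not_le, and_comm]

theorem sumBetter_lt_iff {x : E → ℝ} {v : F ⊕ W} (hx : ∀ e ∈ P.edges v, 0 ≤ x e)
    (hf : P.Filled x v) {e : E} (he : e ∈ P.edges v) :
    P.sumBetter v x e < P.q v ↔ ∃ e' ∈ P.edges v, 0 < x e' ∧ P.rank v e ≤ P.rank v e' := by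
  rw [sumBetter_eq he, ← filled_def.1 hf, sum_filter_lt_iff hx]
  simp only [not_lt, and_comm]

/-- When `x` fills the quota exactly, a partial sum is below it iff mass remains on the omitted
edges. So the critical tie is the worst tie meeting the support. -/
theorem mem_critTie_iff {x : E → ℝ} {v : F ⊕ W} (hx : ∀ e ∈ P.edges v, 0 ≤ x e)
    (hf : P.Filled x v) {e : E} : e ∈ P.critTie x v ↔ e ∈ P.edges v ∧
      (∀ e' ∈ P.edges v, 0 < x e' → P.rank v e' ≤ P.rank v e) ∧
      ∃ e' ∈ P.edges v, 0 < x e' ∧ P.rank v e' = P.rank v e := by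
  unfold critTie
  rw [Finset.mem_filter]
  refine and_congr_right fun he => ?_
  rw [sumBetter_lt_iff hx hf he, ← not_lt, sumBetterEq_lt_iff hx hf he]
  push Not
  constructor
  · rintro ⟨⟨e', h1, h2, h3⟩, h4⟩
    exact ⟨h4, e', h1, h2, le_antisymm (h4 e' h1 h2) h3⟩
  · rintro ⟨h4, e', h1, h2, h3⟩
    exact ⟨⟨e', h1, h2, h3.ge⟩, h4⟩

theorem exists_pos_of_filled {x : E → ℝ} {v : F ⊕ W} (hf : P.Filled x v) :
    ∃ e ∈ P.edges v, 0 < x e := by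
  by_contra! h
  have := Finset.sum_nonpos h
  rw [filled_def.1 hf] at this
  exact absurd (P.q_pos v) this.not_gt

theorem mem_head_iff {x : E → ℝ} {v : F ⊕ W} (hx : ∀ e ∈ P.edges v, 0 ≤ x e) {e : E} :
    e ∈ P.head x v ↔ P.Filled x v ∧ e ∈ P.edges v ∧ 0 < x e ∧ ∀ e' ∈ P.edges v, 0 < x e' →
      P.rank v e' ≤ P.rank v e ∧ (P.rank v e' = P.rank v e → x e' ≤ x e) := by
  unfold head
  split_ifs with hf
  · rw [Finset.mem_filter, mem_critTie_iff hx hf]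
    simp only [mem_critTie_iff hx hf, hf, true_and]
    constructor
    · rintro ⟨⟨h1, h2, e', h3, h4, h5⟩, h6⟩
      have h7 : ∀ a ∈ P.edges v, P.rank v a = P.rank v e → x a ≤ x e := by
        intro a ha hae
        exact h6 a ⟨ha, fun c hc hc' => (h2 c hc hc').trans hae.ge, e', h3, h4, h5.trans hae.symm⟩
      exact ⟨h1, h4.trans_le (h7 e' h3 h5), fun a ha ha' => ⟨h2 a ha ha', h7 a ha⟩⟩
    · rintro ⟨h1, h2, h3⟩
      refine ⟨⟨h1, fun a ha ha' => (h3 a ha ha').1, e, h1, h2, rfl⟩, ?_⟩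
      rintro a ⟨ha, h4, h5⟩
      rcases (hx a ha).eq_or_lt with h6 | h6
      · exact h6 ▸ h2.le
      · exact (h3 a ha h6).2 (le_antisymm (h3 a ha h6).1 (h4 e h1 h2))
  · simp [hf]

/-- This form avoids the critical tie altogether, so tails of different assignments can be compared
even when their critical ties differ. -/
theorem mem_tail_iff {x : E → ℝ} {v : F ⊕ W} (hx : ∀ e ∈ P.edges v, 0 ≤ x e) {e : E} :
    e ∈ P.tail x v ↔ e ∈ P.edges v ∧ (P.Filled x v → ∃ e' ∈ P.edges v, 0 < x e' ∧
      (P.rank v e < P.rank v e' ∨ P.rank v e = P.rank v e' ∧ x e < x e')) := by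
  unfold tail
  split_ifs with hf
  · rw [Finset.mem_union, Finset.mem_sdiff, mem_head_iff hx, beg, Finset.mem_filter,
      mem_critTie_iff hx hf]
    simp only [hf, true_and, true_implies]
    constructor
    · rintro (⟨h1, h2⟩ | ⟨⟨h1, h2, e', h3, h4, h5⟩, h6⟩)
      · obtain ⟨e', h3, h4, h5⟩ := (sumBetterEq_lt_iff hx hf h1).1 h2
        exact ⟨h1, e', h3, h4, Or.inl h5⟩
      · refine ⟨h1, ?_⟩
        by_contra! h7
        refine h6 ⟨h1, h4.trans_le ((h7 e' h3 h4).2 h5.symm), fun a ha ha' =>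
          ⟨(h7 a ha ha').1, fun h => (h7 a ha ha').2 h.symm⟩⟩
    · rintro ⟨h1, h2⟩
      by_cases h3 : P.sumBetterEq v x e < P.q v
      · exact Or.inl ⟨h1, h3⟩
      · right
        rw [sumBetterEq_lt_iff hx hf h1] at h3
        push Not at h3
        obtain ⟨e', h4, h5, h6⟩ := h2
        have h7 := h3 e' h4 h5
        have h8 : P.rank v e = P.rank v e' ∧ x e < x e' := h6.resolve_left (by omega)
        refine ⟨⟨h1, h3, e', h4, h5, h8.1.symm⟩, ?_⟩
        rintro ⟨-, -, h9⟩
        exact absurd ((h9 e' h4 h5).2 h8.1.symm) (not_le.2 h8.2)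
  · simp [hf]

theorem filled_of_notMem_tail {x : E → ℝ} {v : F ⊕ W} {e : E} (he : e ∈ P.edges v)
    (h : e ∉ P.tail x v) : P.Filled x v := by
  by_contra hf
  simp [tail, hf, he] at h

/-- An edge outside the tail is not better than any edge in the support. -/
theorem rank_le_of_notMem_tail {x : E → ℝ} {v : F ⊕ W} (hx : ∀ e ∈ P.edges v, 0 ≤ x e) {e e' : E}
    (he : e ∈ P.edges v) (h : e ∉ P.tail x v) (he' : e' ∈ P.edges v) (hpos : 0 < x e') :
    P.rank v e' ≤ P.rank v e ∧ (P.rank v e' = P.rank v e → x e' ≤ x e) := by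
  have hf := filled_of_notMem_tail he h
  rw [mem_tail_iff hx] at h
  push Not at h
  have := (h he).2 e' he' hpos
  exact ⟨this.1, fun h => this.2 h.symm⟩

theorem mem_head_iff_notMem_tail {x : E → ℝ} {v : F ⊕ W} (hx : ∀ e ∈ P.edges v, 0 ≤ x e) {e : E} :
    e ∈ P.head x v ↔ e ∈ P.edges v ∧ 0 < x e ∧ e ∉ P.tail x v := by
  constructor
  · intro h
    rw [mem_head_iff hx] at h
    refine ⟨h.2.1, h.2.2.1, fun h' => ?_⟩
    obtain ⟨e', h1, h2, h3⟩ := ((mem_tail_iff hx).1 h').2 h.1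
    have h4 := h.2.2.2 e' h1 h2
    rcases h3 with h3 | h3
    · omega
    · exact absurd (h4.2 h3.1.symm) (not_le.2 h3.2)
  · rintro ⟨h1, h2, h3⟩
    exact (mem_head_iff hx).2 ⟨filled_of_notMem_tail h1 h3, h1, h2, fun e' he' hpos =>
      rank_le_of_notMem_tail hx h1 h3 he' hpos⟩

theorem exists_mem_head {x : E → ℝ} {v : F ⊕ W} (hx : ∀ e ∈ P.edges v, 0 ≤ x e)
    (hf : P.Filled x v) : ∃ e, e ∈ P.head x v := by
  have h1 : ((P.edges v).filter fun e => 0 < x e).Nonempty := by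
    obtain ⟨e, h1, h2⟩ := exists_pos_of_filled hf
    exact ⟨e, Finset.mem_filter.2 ⟨h1, h2⟩⟩
  obtain ⟨e, h2, h3⟩ := Finset.exists_max_image _ (P.rank v) h1
  have h4 : ((P.critTie x v)).Nonempty := by
    simp only [Finset.mem_filter] at h2 h3
    exact ⟨e, (mem_critTie_iff hx hf).2 ⟨h2.1, fun a ha ha' => h3 a ⟨ha, ha'⟩, e, h2.1, h2.2, rfl⟩⟩
  obtain ⟨a, h5, h6⟩ := Finset.exists_max_image _ x h4
  exact ⟨a, by rw [head, if_pos hf, Finset.mem_filter]; exact ⟨h5, h6⟩⟩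

/-! ### The choice function -/

theorem exists_cut {α : Type*} {s : Finset α} {z : α → ℝ} (hz : ∀ e ∈ s, 0 ≤ z e) {a : ℝ} (ha : 0 ≤ a)
    (h : a ≤ ∑ e ∈ s, z e) : ∃ r : ℝ, ∑ e ∈ s, min r (z e) = a := by
  have hc : Continuous fun r : ℝ => ∑ e ∈ s, min r (z e) := by fun_prop
  have h0 : ∑ e ∈ s, min 0 (z e) = 0 :=
    Finset.sum_eq_zero fun e he => min_eq_left (hz e he)
  have h1 : ∑ e ∈ s, min (∑ e ∈ s, z e) (z e) = ∑ e ∈ s, z e :=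
    Finset.sum_congr rfl fun e he => min_eq_right (Finset.single_le_sum hz he)
  have := intermediate_value_Icc (Finset.sum_nonneg hz) hc.continuousOn
  obtain ⟨r, -, hr⟩ := this (show a ∈ Set.Icc _ _ by rw [h0, h1]; exact ⟨ha, h⟩)
  exact ⟨r, hr⟩

theorem choice_of_total_le {v : F ⊕ W} {z : E → ℝ} (h : P.total v z ≤ P.q v) (e : E) :
    P.choice v z e = z e := by
  simp [choice, h]

/-- The best tie whose cumulative sum reaches the quota works: the tie just before it has cumulative
sum below the quota, as does the empty sum. -/
theorem exists_critical {v : F ⊕ W} {z : E → ℝ}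
    (h : P.q v < P.total v z) : ∃ e ∈ P.edges v, P.sumBetter v z e < P.q v ∧
      P.q v ≤ P.sumBetterEq v z e := by
  have hne : (P.edges v).Nonempty := by
    rw [Finset.nonempty_iff_ne_empty]
    intro h0
    have := P.q_pos v
    simp [total, h0] at h
    linarith
  have hne' : ((P.edges v).filter fun e => P.q v ≤ P.sumBetterEq v z e).Nonempty := by
    obtain ⟨e, h1, h2⟩ := Finset.exists_max_image _ (P.rank v) hne
    refine ⟨e, Finset.mem_filter.2 ⟨h1, ?_⟩⟩
    rw [sumBetterEq_eq h1, Finset.filter_true_of_mem h2]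
    exact h.le
  obtain ⟨e, h1, h2⟩ := Finset.exists_min_image _ (P.rank v) hne'
  simp only [Finset.mem_filter] at h1 h2
  refine ⟨e, h1.1, ?_, h1.2⟩
  rw [sumBetter_eq h1.1]
  rcases ((P.edges v).filter fun e' => P.rank v e' < P.rank v e).eq_empty_or_nonempty with h3 | h3
  · rw [h3]; simpa using P.q_pos v
  · obtain ⟨a, h4, h5⟩ := Finset.exists_max_image _ (P.rank v) h3
    simp only [Finset.mem_filter] at h4 h5
    by_contra! h6
    have h7 := h2 a ⟨h4.1, ?_⟩
    · omega
    · rw [sumBetterEq_eq h4.1]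
      refine h6.trans_eq (Finset.sum_congr (Finset.filter_congr fun c hc => ?_) fun _ _ => rfl)
      exact ⟨fun h => h5 c ⟨hc, h⟩, fun h => by omega⟩

/-- The shape of the choice function above the quota: better ties are preserved, the critical tie
is cut at some height, and worse ties vanish. -/
theorem choice_spec {v : F ⊕ W} {z : E → ℝ} (hz : ∀ e ∈ P.edges v, 0 ≤ z e)
    (h : P.q v < P.total v z) : ∃ e₀ ∈ P.edges v, ∃ r : ℝ,
      (∀ e ∈ P.edges v, P.rank v e < P.rank v e₀ → P.choice v z e = z e) ∧
      (∀ e ∈ P.edges v, P.rank v e = P.rank v e₀ → P.choice v z e = min r (z e)) ∧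
      (∀ e ∈ P.edges v, P.rank v e₀ < P.rank v e → P.choice v z e = 0) ∧
      ∑ e ∈ P.edges v, P.choice v z e = P.q v ∧ 0 ≤ r := by
  obtain ⟨e₀, he₀, h1, h2⟩ := exists_critical h
  have htot : ¬ P.total v z ≤ P.q v := not_le.2 h
  have h3 : P.sumBetterEq v z e₀ = P.sumBetter v z e₀ +
      ∑ e' ∈ (P.edges v).filter (fun e' => P.equiv v e' e₀), z e' := by
    rw [sumBetterEq_eq he₀, sumBetter_eq he₀, filter_equiv_eq he₀, ← Finset.sum_union]
    · congr 1
      ext a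
      simp only [Finset.mem_filter, Finset.mem_union, ← and_or_left, le_iff_lt_or_eq]
    · rw [Finset.disjoint_filter]
      intro a _ h4 h5
      omega
  have hcut : ∃ r : ℝ, P.sumBetter v z e₀ +
      ∑ e' ∈ (P.edges v).filter (fun e' => P.equiv v e' e₀), min r (z e') = P.q v := by
    obtain ⟨r, hr⟩ := exists_cut (s := (P.edges v).filter (fun e' => P.equiv v e' e₀)) (z := z)
      (fun e he => hz e (Finset.mem_filter.1 he).1) (sub_nonneg.2 h1.le) (by linarith)
    exact ⟨r, by linarith⟩
  have hspec : P.sumBetter v z e₀ +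
      ∑ e' ∈ (P.edges v).filter (fun e' => P.equiv v e' e₀), min (P.cutHeight v z e₀) (z e')
        = P.q v := Classical.epsilon_spec hcut
  have hb : ∀ e ∈ P.edges v, P.rank v e < P.rank v e₀ → P.choice v z e = z e := by
    intro e he hr
    have h4 : P.sumBetterEq v z e ≤ P.sumBetter v z e₀ := by
      rw [sumBetterEq_eq he, sumBetter_eq he₀]
      refine Finset.sum_le_sum_of_subset_of_nonneg (fun a ha => ?_) fun a ha _ =>
        hz a (Finset.mem_filter.1 ha).1
      simp only [Finset.mem_filter] at ha ⊢
      exact ⟨ha.1, by omega⟩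
    have h5 : P.sumBetter v z e ≤ P.sumBetterEq v z e := by
      rw [sumBetterEq_eq he, sumBetter_eq he]
      refine Finset.sum_le_sum_of_subset_of_nonneg (fun a ha => ?_) fun a ha _ =>
        hz a (Finset.mem_filter.1 ha).1
      simp only [Finset.mem_filter] at ha ⊢
      exact ⟨ha.1, by omega⟩
    rw [choice, if_neg htot, if_neg (by linarith), if_pos (by linarith)]
  have hm : ∀ e ∈ P.edges v, P.rank v e = P.rank v e₀ →
      P.choice v z e = min (P.cutHeight v z e₀) (z e) := by
    intro e he hr
    have h4 : P.sumBetter v z e = P.sumBetter v z e₀ := by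
      rw [sumBetter_eq he, sumBetter_eq he₀, hr]
    have h5 : P.sumBetterEq v z e = P.sumBetterEq v z e₀ := by
      rw [sumBetterEq_eq he, sumBetterEq_eq he₀, hr]
    have h6 : P.cutHeight v z e = P.cutHeight v z e₀ := by
      unfold cutHeight
      rw [h4, filter_equiv_eq he, filter_equiv_eq he₀, hr]
    rw [choice, if_neg htot, h4, h5, if_neg (not_le.2 h1), if_neg (not_lt.2 h2), h6]
  have hw : ∀ e ∈ P.edges v, P.rank v e₀ < P.rank v e → P.choice v z e = 0 := by
    intro e he hr
    have h4 : P.sumBetterEq v z e₀ ≤ P.sumBetter v z e := by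
      rw [sumBetterEq_eq he₀, sumBetter_eq he]
      refine Finset.sum_le_sum_of_subset_of_nonneg (fun a ha => ?_) fun a ha _ =>
        hz a (Finset.mem_filter.1 ha).1
      simp only [Finset.mem_filter] at ha ⊢
      exact ⟨ha.1, by omega⟩
    rw [choice, if_neg htot, if_pos (by linarith)]
  refine ⟨e₀, he₀, P.cutHeight v z e₀, hb, hm, hw, ?_, ?_⟩
  · rw [← hspec, sumBetter_eq he₀, filter_equiv_eq he₀,
      ← Finset.sum_filter_add_sum_filter_not (P.edges v) (fun e => P.rank v e < P.rank v e₀)]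
    congr 1
    · refine Finset.sum_congr rfl fun e he => ?_
      rw [Finset.mem_filter] at he
      exact hb e he.1 he.2
    · rw [← Finset.sum_filter_add_sum_filter_not _ (fun e => P.rank v e = P.rank v e₀),
        Finset.filter_filter, Finset.filter_filter]
      rw [Finset.sum_eq_zero (s := Finset.filter (fun a => ¬ P.rank v a < P.rank v e₀ ∧
        ¬ P.rank v a = P.rank v e₀) _), add_zero]
      · refine Finset.sum_congr (Finset.filter_congr fun a _ => ?_) fun a ha => ?_
        · omega
        · rw [Finset.mem_filter] at ha
          exact hm a ha.1 (by omega)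
      · intro a ha
        rw [Finset.mem_filter] at ha
        exact hw a ha.1 (by omega)
  · by_contra! h0
    have : ∑ e' ∈ (P.edges v).filter (fun e' => P.equiv v e' e₀),
        min (P.cutHeight v z e₀) (z e') ≤ 0 :=
      Finset.sum_nonpos fun e _ => (min_le_left _ _).trans h0.le
    linarith

theorem choice_le {v : F ⊕ W} {z : E → ℝ} (hz : ∀ e ∈ P.edges v, 0 ≤ z e) {e : E}
    (he : e ∈ P.edges v) : P.choice v z e ≤ z e := by
  have := hz e he
  unfold choice
  split_ifs
  · exact le_rfl
  · exact this
  · exact le_rfl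
  · exact min_le_right _ _

theorem choice_congr {v : F ⊕ W} {z z' : E → ℝ} (h : ∀ e ∈ P.edges v, z e = z' e) {e : E}
    (he : e ∈ P.edges v) : P.choice v z e = P.choice v z' e := by
  have h1 : P.total v z = P.total v z' := Finset.sum_congr rfl h
  have h2 : P.sumBetter v z e = P.sumBetter v z' e :=
    Finset.sum_congr rfl fun a ha => h a (Finset.mem_filter.1 ha).1
  have h3 : P.sumBetterEq v z e = P.sumBetterEq v z' e :=
    Finset.sum_congr rfl fun a ha => h a (Finset.mem_filter.1 ha).1
  have h4 : P.cutHeight v z e = P.cutHeight v z' e := by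
    unfold cutHeight
    congr 1
    funext r
    rw [h2]
    congr 2
    exact Finset.sum_congr rfl fun a ha => by rw [h a (Finset.mem_filter.1 ha).1]
  rw [choice, choice, h1, h2, h3, h4, h e he]

theorem eqOn_of_le_of_sum_le {α : Type*} {s : Finset α} {x y : α → ℝ} (h : ∀ e ∈ s, x e ≤ y e)
    (hs : ∑ e ∈ s, y e ≤ ∑ e ∈ s, x e) : ∀ e ∈ s, x e = y e :=
  (Finset.sum_eq_sum_iff_of_le h).1 (le_antisymm (Finset.sum_le_sum h) hs)

/-! ### Preferences and stability in terms of tails -/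

theorem stationary_iff {x : E → ℝ} : P.Stationary x ↔ ∀ v, P.InBox v x ∧ P.total v x ≤ P.q v := by
  refine forall_congr' fun v => and_congr_right fun hb => ⟨fun h => ?_, fun h e _ =>
    choice_of_total_le h e⟩
  by_contra! h'
  obtain ⟨-, -, -, -, -, -, h1, -⟩ := choice_spec (fun e he => (hb e he).1) h'
  rw [Finset.sum_congr rfl h] at h1
  exact h'.ne' h1

/-- If the choice from `y ∨ z` is `y`, an edge of the tail lies before the cut, or in the cut tie
with value below the cutting height; there the choice keeps the full maximum. Conversely, bounds on
the tail prevent the choice from exceeding `y`, and equal totals do the rest. -/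
theorem prefers_iff {v : F ⊕ W} {y z : E → ℝ} (hy : ∀ e ∈ P.edges v, 0 ≤ y e)
    (hq : P.total v y ≤ P.q v) :
    P.Prefers v y z ↔ ∀ e ∈ P.tail y v, z e ≤ y e := by
  set u : E → ℝ := fun a => max (y a) (z a) with hu
  have hyu : ∀ e, y e ≤ u e := fun e => le_max_left _ _
  have hzu : ∀ e, z e ≤ u e := fun e => le_max_right _ _
  have hu0 : ∀ e ∈ P.edges v, 0 ≤ u e := fun e he => (hy e he).trans (hyu e)
  constructor
  · intro h e he
    have he' := ((mem_tail_iff hy).1 he).1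
    by_cases ht : P.total v u ≤ P.q v
    · have := h e he'
      rw [choice_of_total_le ht] at this
      exact this ▸ hzu e
    · obtain ⟨e₀, he₀, r, h1, h2, h3, h4, -⟩ := choice_spec hu0 (not_le.1 ht)
      have hc : ∀ e ∈ P.edges v, P.choice v u e = y e := h
      rw [Finset.sum_congr rfl hc] at h4
      obtain ⟨a, ha, hpos, h5⟩ := ((mem_tail_iff hy).1 he).2 h4
      have h6 : P.rank v a ≤ P.rank v e₀ := by
        by_contra! h7
        have := h3 a ha h7
        rw [hc a ha] at this
        exact hpos.ne' this
      by_cases h7 : P.rank v e < P.rank v e₀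
      · rw [← hc e he', h1 e he' h7]
        exact hzu e
      · have h8 := h5.resolve_left (by omega)
        have h9 := h2 a ha (by omega)
        have h10 := h2 e he' (by omega)
        rw [hc a ha] at h9
        rw [hc e he'] at h10
        have h11 : y a ≤ r := h9 ▸ min_le_left _ _
        rcases min_choice r (u e) with h12 | h12
        · rw [h12] at h10; linarith [h8.2]
        · rw [h12] at h10; rw [h10]; exact hzu e
  · intro h
    by_cases ht : P.total v u ≤ P.q v
    · intro e he
      rw [choice_of_total_le ht]
      by_cases hf : P.Filled y v
      · refine (eqOn_of_le_of_sum_le (fun e _ => hyu e) ?_ e he).symm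
        rw [filled_def.1 hf]; exact ht
      · exact max_eq_left (h e (by simpa [tail, hf] using he))
    · obtain ⟨e₀, he₀, r, h1, h2, h3, h4, hr⟩ := choice_spec hu0 (not_le.1 ht)
      have hf : P.Filled y v := by
        by_contra hf
        refine ht (le_trans (Finset.sum_le_sum fun e he => ?_) hq)
        exact max_le le_rfl (h e (by simpa [tail, hf] using he))
      have hle : ∀ e ∈ P.edges v, P.choice v u e ≤ y e := by
        intro e he
        by_cases hT : e ∈ P.tail y v
        · exact (choice_le hu0 he).trans (max_le le_rfl (h e hT))
        · by_contra! hlt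
          have hpos := (hy e he).trans_lt hlt
          have h5 : P.rank v e ≤ P.rank v e₀ := by
            by_contra! h7
            exact hpos.ne' (h3 e he h7)
          -- An edge outside the tail chosen above `y` pushes the cut so far that the choice
          -- dominates `y` everywhere. Both have total `q v`, so they coincide, a contradiction.
          have hge : ∀ a ∈ P.edges v, y a ≤ P.choice v u a := by
            intro a ha
            have h0 : 0 ≤ P.choice v u a := by
              rcases lt_trichotomy (P.rank v a) (P.rank v e₀) with h6 | h6 | h6
              · rw [h1 a ha h6]; exact hu0 a ha
              · rw [h2 a ha h6]
                exact le_min hr (hu0 a ha)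
              · rw [h3 a ha h6]
            rcases (hy a ha).eq_or_lt with h6 | h6
            · rw [← h6]; exact h0
            · have h7 := rank_le_of_notMem_tail hy he hT ha h6
              by_cases h8 : P.rank v a < P.rank v e₀
              · rw [h1 a ha h8]; exact hyu a
              · rw [h2 a ha (by omega)]
                refine le_min ?_ (hyu a)
                have h9 := h2 e he (by omega)
                have h10 := h7.2 (by omega)
                have h11 : P.choice v u e ≤ r := h9 ▸ min_le_left _ _
                linarith
          have := eqOn_of_le_of_sum_le hge (by rw [h4, filled_def.1 hf]) e he
          linarith
      exact eqOn_of_le_of_sum_le hle (by rw [h4, filled_def.1 hf])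

/-- Raising one edge outside the tail leaves `x` preferred to the result, so the choice gives
nothing more there. Raising an unsaturated tail edge displaces less valued mass, or uses free quota
at a deficit vertex. -/
theorem interesting_iff {v : F ⊕ W} {x : E → ℝ} {e : E} (he : e ∈ P.edges v) (hb : P.InBox v x)
    (hq : P.total v x ≤ P.q v) : P.Interesting v x e ↔ x e < P.b e ∧ e ∈ P.tail x v := by
  have hx : ∀ e ∈ P.edges v, 0 ≤ x e := fun e he => (hb e he).1
  constructor
  · rintro ⟨z, hz, hlt, hz', hC⟩
    refine ⟨hlt.trans_le (hz e he).2, ?_⟩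
    by_contra hT
    have h1 : P.Prefers v x z := by
      rw [prefers_iff hx hq]
      intro a ha
      refine (hz' a ((mem_tail_iff hx).1 ha).1 ?_).le
      rintro rfl
      exact hT ha
    have h2 := h1 e he
    rw [choice_congr (z' := z) _ he] at h2
    · exact hC.ne' h2
    · intro a ha
      by_cases hae : a = e
      · rw [hae]; exact max_eq_right hlt.le
      · rw [hz' a ha hae, max_self]
  · rintro ⟨hlt, hT⟩
    by_cases hf : P.Filled x v
    · obtain ⟨a, ha, hpos, h5⟩ := ((mem_tail_iff hx).1 hT).2 hf
      set z := Function.update x e (P.b e) with hzdef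
      have hze : z e = P.b e := by simp [hzdef]
      have hza : ∀ a, a ≠ e → z a = x a := fun a h => by simp [hzdef, h]
      have hxz : ∀ a, x a ≤ z a := by
        intro a
        by_cases h : a = e
        · rw [h, hze]; exact hlt.le
        · rw [hza a h]
      have hz0 : ∀ a ∈ P.edges v, 0 ≤ z a := fun a ha => (hx a ha).trans (hxz a)
      have ht : P.q v < P.total v z := by
        rw [← filled_def.1 hf]
        exact Finset.sum_lt_sum (fun a _ => hxz a) ⟨e, he, by rw [hze]; exact hlt⟩
      refine ⟨z, ?_, by rwa [hze], fun a _ h => hza a h, ?_⟩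
      · intro a ha
        refine ⟨hz0 a ha, ?_⟩
        by_cases h : a = e
        · rw [h, hze]
        · rw [hza a h]; exact (hb a ha).2
      · obtain ⟨e₀, he₀, r, h1, h2, h3, h4, -⟩ := choice_spec hz0 ht
        -- If `e` gained nothing, the choice would lie below `x` with the same total, hence equal
        -- `x`. But the cutting height is then at least `x a`, which exceeds `x e`.
        by_contra! hle
        have hle' : ∀ a ∈ P.edges v, P.choice v z a ≤ x a := by
          intro a ha
          by_cases h : a = e
          · rw [h]; exact hle
          · exact (choice_le hz0 ha).trans_eq (hza a h)
        have hc := eqOn_of_le_of_sum_le hle' (by rw [h4, filled_def.1 hf])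
        have h6 : P.rank v a ≤ P.rank v e₀ := by
          by_contra! h7
          rw [← hc a ha, h3 a ha h7] at hpos
          exact hpos.false
        have h7 : ¬ P.rank v e < P.rank v e₀ := by
          intro h
          have := h1 e he h
          rw [hc e he, hze] at this
          exact hlt.ne this
        have h8 := h5.resolve_left (by omega)
        have h9 := h2 a ha (by omega)
        have h10 := h2 e he (by omega)
        rw [hc a ha] at h9
        rw [hc e he, hze] at h10
        have h11 : x a ≤ r := h9 ▸ min_le_left _ _
        have : x e < min r (P.b e) := lt_min (h8.2.trans_le h11) hlt
        exact this.ne h10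
    · have hlt' : P.total v x < P.q v := lt_of_le_of_ne hq hf
      set d := min (P.b e - x e) (P.q v - P.total v x) with hd
      have hd0 : 0 < d := lt_min (by linarith) (by linarith)
      have hd1 : d ≤ P.b e - x e := min_le_left _ _
      have hd2 : d ≤ P.q v - P.total v x := min_le_right _ _
      set z := Function.update x e (x e + d) with hzdef
      have hze : z e = x e + d := by simp [hzdef]
      have hza : ∀ a, a ≠ e → z a = x a := fun a h => by simp [hzdef, h]
      have ht : P.total v z ≤ P.q v := by
        have : P.total v z = P.total v x + d := by
          unfold total
          rw [← Finset.add_sum_erase _ _ he, ← Finset.add_sum_erase _ x he, hze,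
            Finset.sum_congr rfl fun a ha => hza a (Finset.ne_of_mem_erase ha)]
          ring
        linarith
      refine ⟨z, ?_, by linarith, fun a _ h => hza a h, ?_⟩
      · intro a ha
        by_cases h : a = e
        · rw [h, hze]; exact ⟨by linarith [hx e he], by linarith⟩
        · rw [hza a h]; exact hb a ha
      · rw [choice_of_total_le ht]; linarith

theorem stable_iff {x : E → ℝ} : P.Stable x ↔ (∀ e, 0 ≤ x e ∧ x e ≤ P.b e) ∧
    (∀ v, P.total v x ≤ P.q v) ∧ ∀ e, x e < P.b e → e ∈ P.tail x (Sum.inl (P.fend e)) →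
      e ∉ P.tail x (Sum.inr (P.wend e)) := by
  unfold Stable
  rw [stationary_iff]
  constructor
  · rintro ⟨h1, h2⟩
    have hb : ∀ e, 0 ≤ x e ∧ x e ≤ P.b e := fun e => (h1 (Sum.inl (P.fend e))).1 e (by simp)
    refine ⟨hb, fun v => (h1 v).2, fun e he hf hw => h2 e ⟨?_, ?_⟩⟩
    · exact (interesting_iff (by simp) (h1 _).1 (h1 _).2).2 ⟨he, hf⟩
    · exact (interesting_iff (by simp) (h1 _).1 (h1 _).2).2 ⟨he, hw⟩
  · rintro ⟨h1, h2, h3⟩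
    have h4 : ∀ v, P.InBox v x := fun v e _ => h1 e
    refine ⟨fun v => ⟨h4 v, h2 v⟩, ?_⟩
    rintro e ⟨h5, h6⟩
    rw [interesting_iff (by simp) (h4 _) (h2 _)] at h5 h6
    exact h3 e h5.1 h5.2 h6.2

end MixedProblem

namespace MixedProblem

variable {F W E : Type*} [Fintype E] {P : MixedProblem F W E}

open scoped Classical

/-! ### Potential heads -/

theorem mem_potHead_iff {x : E → ℝ} {f : F} {e : E} : e ∈ P.potHead x f ↔
    P.Filled x (Sum.inl f) ∧ e ∈ P.potential x f ∧
      ∀ e' ∈ P.potential x f, P.rank (Sum.inl f) e ≤ P.rank (Sum.inl f) e' := by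
  unfold potHead
  split_ifs with hf
  · rw [Finset.mem_filter]
    simp only [hf, true_and]
    refine and_congr_right fun h1 => forall₂_congr fun a ha => ?_
    exact ge_iff (Finset.mem_filter.1 h1).1 (Finset.mem_filter.1 ha).1
  · simp [hf]

theorem mem_potential_iff {x : E → ℝ} {f : F} {e : E} : e ∈ P.potential x f ↔
    P.fend e = f ∧ P.Candidate x e ∧ ∀ e', P.fend e' = f →
      P.rank (Sum.inl f) e' ≤ P.rank (Sum.inl f) e → x e' < P.b e' →
        P.Filled x (Sum.inr (P.wend e')) := by
  rw [potential, Finset.mem_filter, mem_edges_inl]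
  refine and_congr_right fun h1 => and_congr_right fun _ => ?_
  refine forall_congr' fun e' => ?_
  rw [mem_edges_inl]
  refine forall_congr' fun h2 => ?_
  rw [ge_iff (by simpa using h2) (by simpa using h1)]

theorem fend_of_mem_potHead {x : E → ℝ} {f : F} {e : E} (he : e ∈ P.potHead x f) : P.fend e = f :=
  (mem_potential_iff.1 (mem_potHead_iff.1 he).2.1).1

/-! ### Comparing two stable assignments -/

/-- If `y` is weakly preferred to `x` at `v` and `y` is not below `x` at some edge outside the tail of
`x`, then the two assignments agree at `v`. -/
theorem eqOn_of_notMem_tail {v : F ⊕ W} {x y : E → ℝ} (hx : ∀ e ∈ P.edges v, 0 ≤ x e)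
    (hy : ∀ e ∈ P.edges v, 0 ≤ y e) (hyq : P.total v y ≤ P.q v)
    (hyx : ∀ e ∈ P.tail y v, x e ≤ y e) {e : E} (he : e ∈ P.edges v) (heT : e ∉ P.tail x v)
    (hle : x e ≤ y e) (hpos : 0 < y e) : ∀ a ∈ P.edges v, x a = y a := by
  have hf := filled_of_notMem_tail he heT
  -- It suffices that `x ≤ y` at `v`, since `x` already fills the quota. For `a` outside the tail of
  -- `y` with `x a > 0`, the edges `a` and `e` share a tie and `x a ≤ x e ≤ y e ≤ y a`.
  refine eqOn_of_le_of_sum_le (fun a ha => ?_) (by rw [filled_def.1 hf]; exact hyq)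
  by_cases haT : a ∈ P.tail y v
  · exact hyx a haT
  · rcases (hx a ha).eq_or_lt with h0 | h0
    · rw [← h0]; exact hy a ha
    · have h1 := rank_le_of_notMem_tail hx he heT ha h0
      have h2 := rank_le_of_notMem_tail hy ha haT he hpos
      have h3 := le_antisymm h1.1 h2.1
      linarith [h1.2 h3, h2.2 h3.symm]

theorem le_of_notMem_tail {v : F ⊕ W} {x y : E → ℝ} (hx : ∀ e ∈ P.edges v, 0 ≤ x e)
    (hy : ∀ e ∈ P.edges v, 0 ≤ y e) (hyq : P.total v y ≤ P.q v)
    (hyx : ∀ e ∈ P.tail y v, x e ≤ y e) {e : E} (he : e ∈ P.edges v) (heT : e ∉ P.tail x v) :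
    y e ≤ x e := by
  by_contra! h
  exact h.ne (eqOn_of_notMem_tail hx hy hyq hyx he heT h.le ((hx e he).trans_lt h) e he)

theorem total_le_of_prefers {v : F ⊕ W} {x y : E → ℝ} (hxq : P.total v x ≤ P.q v)
    (hyx : ∀ e ∈ P.tail y v, x e ≤ y e) : P.total v x ≤ P.total v y := by
  by_cases hf : P.Filled y v
  · exact hxq.trans_eq hf.symm
  · exact Finset.sum_le_sum fun e he => hyx e (by simpa [tail, hf] using he)

theorem sum_total_inl [Fintype F] (x : E → ℝ) : ∑ f, P.total (Sum.inl f) x = ∑ e, x e := by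
  rw [← Finset.sum_fiberwise Finset.univ P.fend x]
  refine Finset.sum_congr rfl fun f _ => Finset.sum_congr ?_ fun _ _ => rfl
  ext e; simp

theorem sum_total_inr [Fintype W] (x : E → ℝ) : ∑ w, P.total (Sum.inr w) x = ∑ e, x e := by
  rw [← Finset.sum_fiberwise Finset.univ P.wend x]
  refine Finset.sum_congr rfl fun f _ => Finset.sum_congr ?_ fun _ _ => rfl
  ext e; simp

/-- The two assignments differ at the vertex `v`. -/
def DiffersAt (P : MixedProblem F W E) (x y : E → ℝ) (v : F ⊕ W) : Prop :=
  ∃ e ∈ P.edges v, x e ≠ y e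

variable (P) in
/-- Two stable assignments, the second one being weakly preferred by all workers. -/
structure StablePair (x y : E → ℝ) : Prop where
  left : P.Stable x
  right : P.Stable y
  le_inr : ∀ w, ∀ e ∈ P.tail y (Sum.inr w), x e ≤ y e

theorem Stable.nonneg {x : E → ℝ} (hx : P.Stable x) (e : E) : 0 ≤ x e := ((stable_iff.1 hx).1 e).1

theorem Stable.le_b {x : E → ℝ} (hx : P.Stable x) (e : E) : x e ≤ P.b e := ((stable_iff.1 hx).1 e).2

theorem Stable.total_le {x : E → ℝ} (hx : P.Stable x) (v : F ⊕ W) : P.total v x ≤ P.q v :=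
  (stable_iff.1 hx).2.1 v

theorem Stable.notMem_tail {x : E → ℝ} (hx : P.Stable x) {e : E} (he : x e < P.b e)
    (hf : e ∈ P.tail x (Sum.inl (P.fend e))) : e ∉ P.tail x (Sum.inr (P.wend e)) :=
  (stable_iff.1 hx).2.2 e he hf

theorem prefersW_iff {x y : E → ℝ} (hy : P.Stable y) :
    P.PrefersW y x ↔ ∀ w, ∀ e ∈ P.tail y (Sum.inr w), x e ≤ y e :=
  forall_congr' fun _ => prefers_iff (fun e _ => hy.nonneg e) (hy.total_le _)

namespace StablePair

variable {x y : E → ℝ} (h : P.StablePair x y)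
include h

theorem mem_tail_of_lt {e : E} (hlt : x e < y e) : e ∈ P.tail x (Sum.inr (P.wend e)) := by
  by_contra hT
  exact hlt.not_ge (le_of_notMem_tail (fun e _ => h.left.nonneg e) (fun e _ => h.right.nonneg e)
    (h.right.total_le _) (h.le_inr _) (by simp) hT)

/-- Polarity: the firms prefer the first assignment. -/
theorem le_inl (f : F) (e : E) (he : e ∈ P.tail x (Sum.inl f)) : y e ≤ x e := by
  have hf : P.fend e = f := by
    simpa using ((mem_tail_iff (fun e _ => h.left.nonneg e)).1 he).1
  subst hf
  by_contra! hlt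
  -- An edge in the firm's tail that grows towards `y` is unsaturated and in the worker's tail too,
  -- so it would block `x`.
  exact h.left.notMem_tail (hlt.trans_le (h.right.le_b e)) he (h.mem_tail_of_lt hlt)

/-- Since `y e > 0`, the edge `e'` outside the tail of `y` shares a tie with `e` and carries at
least `y e`. If it did not grow, `eqOn_of_notMem_tail` with `x` and `y` exchanged would make them
agree at `f`. -/
theorem rank_le_of_pos {f : F} (hd : P.DiffersAt x y (Sum.inl f)) {e e' : E}
    (he : P.fend e = f) (he' : P.fend e' = f) (hlt : x e < y e)
    (hge : P.rank (Sum.inl f) e' ≤ P.rank (Sum.inl f) e) (hT : e' ∉ P.tail y (Sum.inl f)) :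
    x e' < y e' := by
  by_contra! hle
  obtain ⟨a, ha, hne⟩ := hd
  have hpos := (h.left.nonneg e).trans_lt hlt
  have h1 := rank_le_of_notMem_tail (fun e _ => h.right.nonneg e) (by simpa using he') hT
    (by simpa using he) hpos
  have h2 := h1.2 (le_antisymm h1.1 hge)
  exact hne (eqOn_of_notMem_tail (fun e _ => h.right.nonneg e) (fun e _ => h.left.nonneg e)
    (h.left.total_le _) (h.le_inl f) (by simpa using he') hT hle (by linarith) a ha).symm

theorem lt_of_mem_head {w : W} (hd : P.DiffersAt x y (Sum.inr w)) {e : E}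
    (he : e ∈ P.head x (Sum.inr w)) : y e < x e := by
  rw [mem_head_iff_notMem_tail fun e _ => h.left.nonneg e] at he
  obtain ⟨a, ha, hne⟩ := hd
  by_contra! hle
  exact hne (eqOn_of_notMem_tail (fun e _ => h.left.nonneg e) (fun e _ => h.right.nonneg e)
    (h.right.total_le _) (h.le_inr w) he.1 he.2.2 hle (he.2.1.trans_le hle) a ha)

theorem differsAt_inl {w : W} (hd : P.DiffersAt x y (Sum.inr w)) {e : E}
    (he : e ∈ P.head x (Sum.inr w)) : P.DiffersAt x y (Sum.inl (P.fend e)) :=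
  ⟨e, by simp, (h.lt_of_mem_head hd he).ne'⟩

end StablePair

/-! ### Equal totals, and regularity of the vertices where two stable assignments differ -/

variable [Fintype F] [Fintype W]

namespace StablePair

variable {x y : E → ℝ} (h : P.StablePair x y)
include h

/-- Passing from `x` to `y`, totals do not decrease at workers and do not increase at firms, while
both sides sum to the value over all edges. -/
theorem total_eq (v : F ⊕ W) : P.total v x = P.total v y := by
  have h1 : ∀ w, P.total (Sum.inr w) x ≤ P.total (Sum.inr w) y := fun w =>
    total_le_of_prefers (h.left.total_le _) (h.le_inr w)
  have h2 : ∀ f, P.total (Sum.inl f) y ≤ P.total (Sum.inl f) x := fun f =>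
    total_le_of_prefers (h.right.total_le _) (h.le_inl f)
  have h3 : ∑ e, x e ≤ ∑ e, y e := by
    rw [← sum_total_inr (P := P), ← sum_total_inr (P := P)]
    exact Finset.sum_le_sum fun w _ => h1 w
  have h4 : ∑ e, y e ≤ ∑ e, x e := by
    rw [← sum_total_inl (P := P), ← sum_total_inl (P := P)]
    exact Finset.sum_le_sum fun f _ => h2 f
  rcases v with f | w
  · refine (eqOn_of_le_of_sum_le (fun f _ => h2 f) ?_ f (Finset.mem_univ f)).symm
    rwa [sum_total_inl, sum_total_inl]
  · refine eqOn_of_le_of_sum_le (fun f _ => h1 f) ?_ w (Finset.mem_univ w)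
    rwa [sum_total_inr, sum_total_inr]

theorem filled_iff (v : F ⊕ W) : P.Filled x v ↔ P.Filled y v := by
  rw [Filled, Filled, h.total_eq]

theorem eqOn_of_not_filled {v : F ⊕ W} (hv : ¬ P.Filled x v) : ∀ e ∈ P.edges v, x e = y e := by
  rcases v with f | w
  · intro e he
    refine (eqOn_of_le_of_sum_le (fun a ha => h.le_inl f a ?_) (h.total_eq _).le e he).symm
    simpa [tail, hv] using ha
  · refine eqOn_of_le_of_sum_le (fun a ha => h.le_inr w a ?_) (h.total_eq _).ge
    rw [h.filled_iff] at hv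
    simpa [tail, hv] using ha

theorem filled_of_differsAt {v : F ⊕ W} (hv : P.DiffersAt x y v) : P.Filled x v := by
  by_contra hf
  obtain ⟨e, he, hne⟩ := hv
  exact hne (h.eqOn_of_not_filled hf e he)

/-- An unsaturated edge to a deficit worker is the same in `x` and `y`, and lies in the worker's
tail, so stability of `y` puts it outside the firm's tail. Were it at least as good as `e`, it would
have to grow by `rank_le_of_pos`. -/
theorem mem_potential {f : F} (hd : P.DiffersAt x y (Sum.inl f)) {e : E} (he : P.fend e = f)
    (hlt : x e < y e) : e ∈ P.potential x f := by
  refine Finset.mem_filter.2 ⟨by simpa using he,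
    ⟨hlt.trans_le (h.right.le_b e), h.mem_tail_of_lt hlt⟩, fun e' he' hge hb => ?_⟩
  by_contra hw
  have h1 := h.eqOn_of_not_filled hw e' (by simp)
  rw [h1] at hb
  have h2 : e' ∉ P.tail y (Sum.inl f) := by
    intro h3
    have he'' : P.fend e' = f := by simpa using he'
    subst he''
    refine h.right.notMem_tail hb h3 ?_
    rw [h.filled_iff] at hw
    simp [tail, hw]
  rw [ge_iff he' (by simpa using he)] at hge
  exact (h.rank_le_of_pos hd he (by simpa using he') hlt hge h2).ne h1

theorem exists_lt {f : F} (hd : P.DiffersAt x y (Sum.inl f)) : ∃ e, P.fend e = f ∧ x e < y e := by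
  by_contra! h1
  obtain ⟨a, ha, hne⟩ := hd
  exact hne (eqOn_of_le_of_sum_le (fun a ha => h1 a (by simpa using ha)) (h.total_eq _).le a ha).symm

theorem potHead_nonempty {f : F} (hd : P.DiffersAt x y (Sum.inl f)) : (P.potHead x f).Nonempty := by
  obtain ⟨e, he, hlt⟩ := h.exists_lt hd
  obtain ⟨a, ha, hmin⟩ := Finset.exists_min_image _ (P.rank (Sum.inl f))
    ⟨e, h.mem_potential hd he hlt⟩
  refine ⟨a, ?_⟩
  rw [potHead, if_pos (h.filled_of_differsAt hd), Finset.mem_filter]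
  exact ⟨ha, fun e' he' => (ge_iff (Finset.mem_filter.1 ha).1 (Finset.mem_filter.1 he').1).2
    (hmin e' he')⟩

/-- If `e` did not grow, it would be unsaturated in `y`, hence outside the firm's tail by stability.
The potential head is at least as good as any growing edge, so `rank_le_of_pos` makes `e` grow after
all. -/
theorem lt_of_mem_potHead {f : F} (hd : P.DiffersAt x y (Sum.inl f)) {e : E}
    (he : e ∈ P.potHead x f) (hT : e ∈ P.tail y (Sum.inr (P.wend e))) : x e < y e := by
  obtain ⟨a, ha, hlt⟩ := h.exists_lt hd
  have h1 := mem_potHead_iff.1 he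
  have h2 := mem_potential_iff.1 h1.2.1
  by_contra! hle
  refine hle.not_gt (h.rank_le_of_pos hd ha h2.1 hlt (h1.2.2 a (h.mem_potential hd ha hlt)) ?_)
  intro h3
  have h4 := h2.1
  subst h4
  exact h.right.notMem_tail (hle.trans_lt h2.2.1.1) h3 hT

/-- At an unchanged worker the tails of `x` and `y` coincide, so `e` would be in the tail of `y` and
would grow. -/
theorem differsAt_inr {f : F} (hd : P.DiffersAt x y (Sum.inl f)) {e : E}
    (he : e ∈ P.potHead x f) : P.DiffersAt x y (Sum.inr (P.wend e)) := by
  by_contra hw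
  have h1 : ∀ a, P.wend a = P.wend e → x a = y a := by
    intro a ha
    by_contra hne
    exact hw ⟨a, by simpa using ha, hne⟩
  have h2 := (mem_potential_iff.1 (mem_potHead_iff.1 he).2.1).2.1.2
  refine (h.lt_of_mem_potHead hd he ?_).ne (h1 e rfl)
  rw [mem_tail_iff fun e _ => h.left.nonneg e] at h2
  rw [mem_tail_iff fun e _ => h.right.nonneg e, ← h.filled_iff]
  refine ⟨h2.1, fun h3 => ?_⟩
  obtain ⟨a, ha, h4⟩ := h2.2 h3
  refine ⟨a, ha, ?_⟩
  rwa [← h1 a (by simpa using ha), ← h1 e rfl]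

theorem not_singular {v : F ⊕ W} (hv : P.DiffersAt x y v) : ¬ P.Singular x v := by
  intro hs
  induction hs with
  | deficitHead w e _ he hf => exact hf (h.filled_of_differsAt (h.differsAt_inl hv he))
  | emptyHead f _ he => exact (h.potHead_nonempty hv).ne_empty he
  | stepW w e _ he _ ih => exact ih (h.differsAt_inl hv he)
  | stepF f e _ he _ ih => exact ih (h.differsAt_inr hv he)

theorem regular_of_differsAt {v : F ⊕ W} (hv : P.DiffersAt x y v) : P.Regular x v :=
  ⟨h.filled_of_differsAt hv, h.not_singular hv⟩

theorem differsAt_of_arc {u v : F ⊕ W} (hu : P.DiffersAt x y u) (ha : P.Arc x u v) :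
    P.DiffersAt x y v := by
  cases ha with
  | ofF e he => exact h.differsAt_inr hu he.2
  | ofW e he => exact h.differsAt_inl hu he.2

end StablePair

end MixedProblem

/-! ### Stationary vectors of finite directed multigraphs -/

open scoped Classical in
/-- Every nonempty vertex set of a finite directed multigraph that is closed under out-arcs supports a
nonzero nonnegative integral stationary vector. -/
theorem exists_stationary_vector {V K : Type*} [Fintype V] [Fintype K] (src tgt : K → V)
    (a : K → Prop) (s : Set V) (hs : s.Nonempty) (hclosed : ∀ k, a k → src k ∈ s → tgt k ∈ s) :
    ∃ g : V → ℤ, (∀ v, 0 ≤ g v) ∧ (∀ v, v ∉ s → g v = 0) ∧ (∃ v, g v ≠ 0) ∧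
      ∀ v, ((Finset.univ.filter fun k => a k ∧ src k = v).card : ℤ) * g v =
        ∑ k ∈ Finset.univ.filter (fun k => a k ∧ tgt k = v), g (src k) := by
  set d : V → ℤ := fun u => ((Finset.univ.filter fun k => a k ∧ src k = u).card : ℤ) with hd
  set m : V → V → ℤ := fun v u =>
    ((Finset.univ.filter fun k => a k ∧ src k = u ∧ tgt k = v).card : ℤ) with hm
  -- Out-degrees minus arc counts on the columns of `s`, identity columns elsewhere. As `s` is
  -- closed, the rows outside `s` are identity rows too, so kernel vectors vanish off `s`.
  set N : Matrix V V ℤ := fun v u =>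
    if u ∈ s then (if v = u then d u else 0) - m v u else if v = u then 1 else 0 with hN
  have hm0 : ∀ u ∈ s, ∀ v, v ∉ s → m v u = 0 := by
    intro u hu v hv
    simp only [hm, Nat.cast_eq_zero, Finset.card_eq_zero, Finset.filter_eq_empty_iff]
    rintro k - ⟨h1, h2, h3⟩
    exact hv (h3 ▸ hclosed k h1 (h2 ▸ hu))
  have hmsum : ∀ u, ∑ v, m v u = d u := by
    intro u
    simp only [hm, hd]
    rw [← Nat.cast_sum, Finset.card_eq_sum_card_fiberwise (f := tgt) (t := Finset.univ)
      (fun _ _ => Finset.mem_univ _)]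
    simp only [Finset.filter_filter, and_assoc]
  have hdet : N.det = 0 := by
    -- The indicator of `s` is a left null vector: each arc leaving a vertex of `s` is counted once
    -- in its out-degree and once at its target in `s`.
    refine Matrix.exists_vecMul_eq_zero_iff.1 ⟨fun v => if v ∈ s then 1 else 0, ?_, ?_⟩
    · obtain ⟨v, hv⟩ := hs
      intro h
      simpa [hv] using congrFun h v
    · funext u
      simp only [Matrix.vecMul, dotProduct, ite_mul, one_mul, zero_mul, Pi.zero_apply, hN]
      by_cases hu : u ∈ s
      · have h1 : ∀ v, (if v ∈ s then (if u ∈ s then (if v = u then d u else 0) - m v u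
            else if v = u then 1 else 0) else 0) = (if v = u then d u else 0) - m v u := by
          intro v
          by_cases hv : v ∈ s
          · simp [hu, hv]
          · have : v ≠ u := by rintro rfl; exact hv hu
            simp [hv, this, hm0 u hu v hv]
        rw [Finset.sum_congr rfl fun v _ => h1 v, Finset.sum_sub_distrib, hmsum]
        simp
      · refine Finset.sum_eq_zero fun v _ => ?_
        by_cases hv : v ∈ s
        · have : v ≠ u := by rintro rfl; exact hu hv
          simp [hu, this]
        · simp [hv]
  obtain ⟨g, hg0, hg⟩ := Matrix.exists_mulVec_eq_zero_iff.2 hdet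
  have hgs : ∀ v, v ∉ s → g v = 0 := by
    intro v hv
    have h1 := congrFun hg v
    simp only [Matrix.mulVec, dotProduct, hN, Pi.zero_apply] at h1
    rw [Finset.sum_eq_single v] at h1
    · simpa [hv] using h1
    · intro u _ huv
      by_cases hu : u ∈ s
      · simp [hu, huv.symm, hm0 u hu v hv]
      · simp [hu, huv.symm]
    · simp
  have hmg : ∀ (w : V → ℤ) (v : V), ∑ u, m v u * w u =
      ∑ k ∈ Finset.univ.filter (fun k => a k ∧ tgt k = v), w (src k) := by
    intro w v
    rw [← Finset.sum_fiberwise_of_maps_to (g := src) (t := Finset.univ)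
      (fun _ _ => Finset.mem_univ _)]
    refine Finset.sum_congr rfl fun u _ => ?_
    rw [Finset.filter_filter, Finset.sum_congr rfl (g := fun _ => w u), Finset.sum_const,
      nsmul_eq_mul]
    · simp only [hm]
      congr 3
      refine Finset.filter_congr fun k _ => ?_
      tauto
    · intro k hk
      rw [(Finset.mem_filter.1 hk).2.2]
  have hbal : ∀ v, d v * g v =
      ∑ k ∈ Finset.univ.filter (fun k => a k ∧ tgt k = v), g (src k) := by
    intro v
    by_cases hv : v ∈ s
    · have h1 := congrFun hg v
      simp only [Matrix.mulVec, dotProduct, hN, Pi.zero_apply] at h1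
      have h2 : ∀ u, (if u ∈ s then (if v = u then d u else 0) - m v u
          else if v = u then 1 else 0) * g u = (if v = u then d u * g u else 0) - m v u * g u := by
        intro u
        by_cases hu : u ∈ s
        · by_cases hvu : v = u <;> simp [hu, hvu, sub_mul]
        · simp [hgs u hu]
      rw [Finset.sum_congr rfl fun u _ => h2 u, Finset.sum_sub_distrib, hmg] at h1
      simp only [Finset.sum_ite_eq, Finset.mem_univ, if_true] at h1
      linarith
    · rw [hgs v hv, mul_zero, Finset.sum_eq_zero]
      intro k hk
      rw [Finset.mem_filter] at hk
      refine hgs _ fun h => hv ?_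
      rw [← hk.2.2]
      exact hclosed k hk.2.1 h
  -- Absolute values turn balance into outflow ≤ inflow at each vertex. Both sides sum to the same
  -- total over all vertices, so equality holds everywhere.
  refine ⟨fun v => |g v|, fun v => abs_nonneg _, fun v hv => by simp [hgs v hv], ?_, ?_⟩
  · by_contra! h
    exact hg0 (funext fun v => by simpa using h v)
  · have hle : ∀ v ∈ Finset.univ, d v * |g v| ≤
        ∑ k ∈ Finset.univ.filter (fun k => a k ∧ tgt k = v), |g (src k)| := by
      intro v _
      have h1 : d v * |g v| = |d v * g v| := by
        rw [abs_mul, abs_of_nonneg (a := d v) (by simp [hd])]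
      rw [h1, hbal]
      exact Finset.abs_sum_le_sum_abs _ _
    have hsum : ∑ v, ∑ k ∈ Finset.univ.filter (fun k => a k ∧ tgt k = v), |g (src k)| =
        ∑ v, d v * |g v| := by
      have h1 : ∀ v, ∑ k ∈ Finset.univ.filter (fun k => a k ∧ src k = v), |g (src k)| =
          d v * |g v| := by
        intro v
        rw [Finset.sum_congr rfl (g := fun _ => |g v|), Finset.sum_const, nsmul_eq_mul]
        intro k hk
        rw [(Finset.mem_filter.1 hk).2.2]
      rw [← Finset.sum_congr rfl fun v _ => h1 v]
      have h2 := Finset.sum_fiberwise (Finset.univ.filter a) tgt fun k => |g (src k)|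
      have h3 := Finset.sum_fiberwise (Finset.univ.filter a) src fun k => |g (src k)|
      simp only [Finset.filter_filter] at h2 h3
      rw [h2, h3]
    intro v
    exact (Finset.sum_eq_sum_iff_of_le hle).1 hsum.symm v (Finset.mem_univ v)

namespace MixedProblem

variable {F W E : Type*} [Fintype E] {P : MixedProblem F W E}

open scoped Classical

/-! ### The active graph -/

theorem ActiveF.mem_tail {x : E → ℝ} {e : E} (he : P.ActiveF x e) :
    e ∈ P.tail x (Sum.inr (P.wend e)) :=
  (mem_potential_iff.1 (mem_potHead_iff.1 he.2).2.1).2.1.2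

theorem ActiveF.lt_b {x : E → ℝ} {e : E} (he : P.ActiveF x e) : x e < P.b e :=
  (mem_potential_iff.1 (mem_potHead_iff.1 he.2).2.1).2.1.1

theorem ActiveF.regular_inr {x : E → ℝ} {e : E} (he : P.ActiveF x e) :
    P.Regular x (Sum.inr (P.wend e)) :=
  ⟨(mem_potential_iff.1 (mem_potHead_iff.1 he.2).2.1).2.2 e rfl le_rfl he.lt_b,
    fun hs => he.1.2 (Singular.stepF _ e he.1.1 he.2 hs)⟩

theorem ActiveW.regular_inl {x : E → ℝ} {e : E} (he : P.ActiveW x e) :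
    P.Regular x (Sum.inl (P.fend e)) := by
  refine ⟨?_, fun hs => he.1.2 (Singular.stepW _ e he.1.1 he.2 hs)⟩
  by_contra hf
  exact he.1.2 (Singular.deficitHead _ e he.1.1 he.2 hf)

theorem activeW_iff {x : E → ℝ} (hx : ∀ e, 0 ≤ x e) {e : E} : P.ActiveW x e ↔
    P.Regular x (Sum.inr (P.wend e)) ∧ 0 < x e ∧ e ∉ P.tail x (Sum.inr (P.wend e)) := by
  rw [ActiveW, mem_head_iff_notMem_tail fun e _ => hx e]
  simp

theorem ActiveF.not_activeW {x : E → ℝ} (hx : ∀ e, 0 ≤ x e) {e : E} (he : P.ActiveF x e) :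
    ¬ P.ActiveW x e :=
  fun h => ((activeW_iff hx).1 h).2.2 he.mem_tail

theorem Arc.regular_left {x : E → ℝ} {u v : F ⊕ W} (h : P.Arc x u v) : P.Regular x u := by
  cases h with
  | ofF e he => exact he.1
  | ofW e he => exact he.1

theorem Arc.regular_right {x : E → ℝ} {u v : F ⊕ W} (h : P.Arc x u v) : P.Regular x v := by
  cases h with
  | ofF e he => exact he.regular_inr
  | ofW e he => exact he.regular_inl

theorem Arc.ne {x : E → ℝ} {u v : F ⊕ W} (h : P.Arc x u v) : u ≠ v := by
  cases h <;> simp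

theorem Regular.exists_arc {x : E → ℝ} (hx : ∀ e, 0 ≤ x e) {v : F ⊕ W} (hv : P.Regular x v) :
    ∃ u, P.Arc x v u := by
  rcases v with f | w
  · have h1 : (P.potHead x f).Nonempty := by
      rw [Finset.nonempty_iff_ne_empty]
      exact fun h => hv.2 (Singular.emptyHead f hv.1 h)
    obtain ⟨e, he⟩ := h1
    obtain rfl := fend_of_mem_potHead he
    exact ⟨_, Arc.ofF e ⟨hv, he⟩⟩
  · obtain ⟨e, he⟩ := exists_mem_head (fun e _ => hx e) hv.1
    have h2 : P.wend e = w := by simpa using ((mem_head_iff fun e _ => hx e).1 he).2.1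
    subst h2
    exact ⟨_, Arc.ofW e ⟨hv, he⟩⟩

/-! ### Maximal strong components -/

/-- A nonempty set of regular vertices closed under arcs contains a maximal strong component. -/
theorem exists_isMaxComponent [Finite F] [Finite W] {x : E → ℝ} (hx : ∀ e, 0 ≤ x e)
    {D : Set (F ⊕ W)} (hD : D.Nonempty) (hreg : ∀ v ∈ D, P.Regular x v)
    (hclosed : ∀ u ∈ D, ∀ v, P.Arc x u v → v ∈ D) : ∃ L ⊆ D, P.IsMaxComponent x L := by
  -- A vertex with fewest reachable vertices: whatever it reaches has the same reachable set and so
  -- reaches it back.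
  obtain ⟨v, hv, hmin⟩ := D.toFinite.exists_minimalFor (fun v => {u | P.Reach x v u}.ncard) D hD
  set R : Set (F ⊕ W) := {u | P.Reach x v u} with hR
  have hRD : ∀ u ∈ R, u ∈ D := by
    intro u hu
    induction hu with
    | refl => exact hv
    | tail _ h2 ih => exact hclosed _ ih _ h2
  have hback : ∀ u ∈ R, P.Reach x u v := by
    intro u hu
    have h1 : {a | P.Reach x u a} ⊆ R := fun a ha => Relation.ReflTransGen.trans hu ha
    have h2 := hmin (hRD u hu) (Set.ncard_le_ncard h1 (Set.toFinite _))
    have h3 := Set.eq_of_subset_of_ncard_le h1 h2 (Set.toFinite _)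
    have h4 : v ∈ R := Relation.ReflTransGen.refl
    rwa [← h3] at h4
  have hstrong : P.IsStrongComponent x R := by
    refine ⟨⟨?_, fun a ha c hc => (hback a ha).trans hc⟩, ?_⟩
    · obtain ⟨u, hu⟩ := (hreg v hv).exists_arc hx
      exact ⟨v, Relation.ReflTransGen.refl, u, Relation.ReflTransGen.single hu, hu.ne⟩
    · intro S hS hRS a ha
      exact hS.2 v (hRS Relation.ReflTransGen.refl) a ha
  refine ⟨R, hRD, hstrong, ?_⟩
  rintro L' hL' ⟨u, hu, a, ha, hua⟩
  have h1 : L' ⊆ R := fun c hc => (hu.trans hua).trans (hL'.1.2 a ha c hc)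
  exact le_antisymm h1 (hL'.2 hstrong.1 h1)

theorem IsMaxComponent.regular {x : E → ℝ} {L : Set (F ⊕ W)} (hL : P.IsMaxComponent x L) {v : F ⊕ W}
    (hv : v ∈ L) : P.Regular x v := by
  obtain ⟨u, hu, hne⟩ := hL.1.1.1.exists_ne v
  rcases (hL.1.1.2 v hv u hu).cases_head with h | ⟨a, h, -⟩
  · exact absurd h.symm hne
  · exact h.regular_left

/-- The vertices reachable from `v` contain a maximal component. It is reachable from `L`, hence
equals `L`, so `v` reaches `L` and is reached from it. -/
theorem IsMaxComponent.mem_of_arc [Finite F] [Finite W] {x : E → ℝ} (hx : ∀ e, 0 ≤ x e)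
    {L : Set (F ⊕ W)} (hL : P.IsMaxComponent x L) {u v : F ⊕ W} (hu : u ∈ L) (huv : P.Arc x u v) :
    v ∈ L := by
  have hreg : ∀ a, P.Reach x v a → P.Regular x a := by
    intro a ha
    induction ha with
    | refl => exact huv.regular_right
    | tail _ h2 ih => exact h2.regular_right
  obtain ⟨L', hL'D, hL'⟩ := exists_isMaxComponent (D := {a | P.Reach x v a}) hx
    ⟨v, Relation.ReflTransGen.refl⟩ hreg fun a ha c hc => Relation.ReflTransGen.tail ha hc
  obtain ⟨a, ha⟩ := hL'.1.1.1.nonempty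
  have h1 := hL.2 L' hL'.1 ⟨u, hu, a, ha, Relation.ReflTransGen.head huv (hL'D ha)⟩
  subst h1
  have hvu : P.Reach x v u := hL'D hu
  have huv' : P.Reach x u v := Relation.ReflTransGen.single huv
  refine hL.1.2 (y := insert v L') ⟨hL.1.1.1.mono (Set.subset_insert _ _), ?_⟩
    (Set.subset_insert _ _) (Set.mem_insert _ _)
  rintro a (rfl | ha) c (rfl | hc)
  · exact Relation.ReflTransGen.refl
  · exact hvu.trans (hL.1.1.2 u hu c hc)
  · exact (hL.1.1.2 a ha u hu).trans huv'
  · exact hL.1.1.2 a ha c hc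

theorem head_eq_filter {x : E → ℝ} (hx : ∀ e, 0 ≤ x e) {w : W} (hw : P.Regular x (Sum.inr w)) :
    P.head x (Sum.inr w) = (P.edges (Sum.inr w)).filter fun e => P.ActiveW x e := by
  ext e
  rw [Finset.mem_filter, mem_edges_inr]
  constructor
  · intro he
    have h2 : P.wend e = w := by simpa using ((mem_head_iff fun e _ => hx e).1 he).2.1
    subst h2
    exact ⟨rfl, hw, he⟩
  · rintro ⟨rfl, h⟩
    exact h.2

theorem potHead_eq_filter {x : E → ℝ} {f : F} (hf : P.Regular x (Sum.inl f)) :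
    P.potHead x f = (P.edges (Sum.inl f)).filter fun e => P.ActiveF x e := by
  ext e
  rw [Finset.mem_filter, mem_edges_inl]
  constructor
  · intro he
    obtain rfl := fend_of_mem_potHead he
    exact ⟨rfl, hf, he⟩
  · rintro ⟨rfl, h⟩
    exact h.2

/-! ### Rotations -/

variable (P) in
/-- The properties of rotations that govern the shifts along them. -/
structure IsShiftDirection (x : E → ℝ) (ρ : E → ℤ) : Prop where
  activeF : ∀ e, 0 < ρ e → P.ActiveF x e
  activeW : ∀ e, ρ e < 0 → P.ActiveW x e
  sum_eq_zero : ∀ v, ∑ e ∈ P.edges v, ρ e = 0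
  eq_of_activeF : ∀ e e', P.fend e = P.fend e' → P.ActiveF x e → P.ActiveF x e' → ρ e = ρ e'
  eq_of_activeW : ∀ e e', P.wend e = P.wend e' → P.ActiveW x e → P.ActiveW x e' → ρ e = ρ e'
  ne_zero : ρ ≠ 0

variable [Fintype F] [Fintype W]

/-- Edges active for `F` lie in worker tails and edges active for `W` in heads, so no edge is both.
Nonnegativity of `φ` and `ψ` then lets the sign of `ρ e` determine the kind of activity. -/
theorem IsRotation.isShiftDirection {x : E → ℝ} (hx : ∀ e, 0 ≤ x e) {L : Set (F ⊕ W)} {ρ : E → ℤ}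
    (h : P.IsRotation x L ρ) :
    P.IsShiftDirection x ρ ∧ ∀ e, 0 < ρ e → Sum.inl (P.fend e) ∈ L := by
  obtain ⟨hcirc, -, -, ε, φ, ψ, -, hsol, hφ, -, c, hc, hρ⟩ := h
  have hF : ∀ e, P.ActiveF x e → (ρ e : ℝ) = c * φ (P.fend e) := by
    intro e he
    rw [hρ e, delta, if_pos he]
  have hW : ∀ e, P.ActiveW x e → (ρ e : ℝ) = c * - ψ (P.wend e) := by
    intro e he
    rw [hρ e, delta, if_neg fun h => h.not_activeW hx he, if_pos he]
  have h0 : ∀ e, ¬ P.ActiveF x e → ¬ P.ActiveW x e → ρ e = 0 := by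
    intro e h1 h2
    have := hρ e
    rw [delta, if_neg h1, if_neg h2, mul_zero] at this
    exact_mod_cast this
  have hpos : ∀ e, 0 < ρ e → P.ActiveF x e := by
    intro e he
    by_contra h1
    by_cases h2 : P.ActiveW x e
    · have h3 := hW e h2
      have h4 := mul_nonneg hc.le (hsol.nonnegW _ h2.1)
      have h5 : (0 : ℝ) < ρ e := by exact_mod_cast he
      linarith
    · exact he.ne' (h0 e h1 h2)
  refine ⟨⟨hpos, ?_, hcirc.2, ?_, ?_, hcirc.1⟩, ?_⟩
  · intro e he
    by_contra h2
    by_cases h1 : P.ActiveF x e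
    · have h3 := hF e h1
      have h4 := mul_nonneg hc.le (hsol.nonnegF _ h1.1)
      have h5 : (ρ e : ℝ) < 0 := by exact_mod_cast he
      linarith
    · exact he.ne (h0 e h1 h2)
  · intro e e' he h1 h2
    have := (hF e h1).trans ((congrArg (fun f => c * φ f) he).trans (hF e' h2).symm)
    exact_mod_cast this
  · intro e e' he h1 h2
    have := (hW e h1).trans ((congrArg (fun f => c * - ψ f) he).trans (hW e' h2).symm)
    exact_mod_cast this
  · intro e he
    by_contra hL
    have := hF e (hpos e he)
    rw [hφ _ hL, mul_zero] at this
    exact he.ne' (by exact_mod_cast this)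

/-- Every maximal strong component has a rotation. -/
theorem IsMaxComponent.exists_isRotation {x : E → ℝ} (hx : ∀ e, 0 ≤ x e) {L : Set (F ⊕ W)}
    (hL : P.IsMaxComponent x L) : ∃ ρ, P.IsRotation x L ρ := by
  -- Each edge is offered twice as a possible arc, once from each end. The balance equations of the
  -- stationary vector are then exactly the system for `φ` and `ψ`.
  obtain ⟨g, hg0, hgL, ⟨v₀, hv₀⟩, hbal⟩ := exists_stationary_vector (K := E ⊕ E)
    (Sum.elim (fun e => Sum.inl (P.fend e)) (fun e => Sum.inr (P.wend e)))
    (Sum.elim (fun e => Sum.inr (P.wend e)) (fun e => Sum.inl (P.fend e)))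
    (Sum.elim (P.ActiveF x) (P.ActiveW x)) L hL.1.1.1.nonempty (by
      rintro (e | e) h1 h2
      · exact hL.mem_of_arc hx h2 (Arc.ofF e h1)
      · exact hL.mem_of_arc hx h2 (Arc.ofW e h1))
  have hbalF : ∀ f, P.Regular x (Sum.inl f) → ((P.potHead x f).card : ℤ) * g (Sum.inl f) =
      ∑ e ∈ (P.edges (Sum.inl f)).filter (fun e => P.ActiveW x e), g (Sum.inr (P.wend e)) := by
    intro f hf
    have h1 := hbal (Sum.inl f)
    rw [Finset.card_filter, Finset.sum_filter, Fintype.sum_sum_type, Fintype.sum_sum_type] at h1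
    simp only [Sum.elim_inl, Sum.elim_inr, Sum.inl.injEq, reduceCtorEq, and_false, if_false,
      Finset.sum_const_zero, add_zero, zero_add] at h1
    have h2 : ∀ p : E → Prop, (P.edges (Sum.inl f)).filter p =
        Finset.univ.filter fun e => p e ∧ P.fend e = f := by
      intro p
      ext e
      simp [and_comm]
    rw [potHead_eq_filter hf, h2, h2, Finset.card_filter, Finset.sum_filter]
    exact h1
  have hbalW : ∀ w, P.Regular x (Sum.inr w) → ((P.head x (Sum.inr w)).card : ℤ) * g (Sum.inr w) =
      ∑ e ∈ (P.edges (Sum.inr w)).filter (fun e => P.ActiveF x e), g (Sum.inl (P.fend e)) := by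
    intro f hf
    have h1 := hbal (Sum.inr f)
    rw [Finset.card_filter, Finset.sum_filter, Fintype.sum_sum_type, Fintype.sum_sum_type] at h1
    simp only [Sum.elim_inl, Sum.elim_inr, Sum.inr.injEq, reduceCtorEq, and_false, if_false,
      Finset.sum_const_zero, add_zero, zero_add] at h1
    have h2 : ∀ p : E → Prop, (P.edges (Sum.inr f)).filter p =
        Finset.univ.filter fun e => p e ∧ P.wend e = f := by
      intro p
      ext e
      simp [and_comm]
    rw [head_eq_filter hx hf, h2, h2, Finset.card_filter, Finset.sum_filter]
    exact h1
  set ρ₀ : E → ℤ := fun e => if P.ActiveF x e then g (Sum.inl (P.fend e)) else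
    if P.ActiveW x e then - g (Sum.inr (P.wend e)) else 0 with hρ₀
  have hsum : ∀ v, ∑ e ∈ P.edges v, ρ₀ e = 0 := by
    intro v
    have h1 : ∀ e, ρ₀ e = (if P.ActiveF x e then g (Sum.inl (P.fend e)) else 0) -
        (if P.ActiveW x e then g (Sum.inr (P.wend e)) else 0) := by
      intro e
      simp only [hρ₀]
      by_cases h1 : P.ActiveF x e
      · simp [h1, h1.not_activeW hx]
      · by_cases h2 : P.ActiveW x e <;> simp [h1, h2]
    rw [Finset.sum_congr rfl fun e _ => h1 e, Finset.sum_sub_distrib, ← Finset.sum_filter,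
      ← Finset.sum_filter, sub_eq_zero]
    by_cases hv : P.Regular x v
    · rcases v with f | w
      · rw [← hbalF f hv, ← potHead_eq_filter hv, Finset.sum_congr rfl (g := fun _ => g (Sum.inl f)),
          Finset.sum_const, nsmul_eq_mul]
        intro e he
        rw [fend_of_mem_potHead he]
      · rw [← hbalW w hv, head_eq_filter hx hv,
          Finset.sum_congr rfl (s₁ := Finset.filter (fun e => P.ActiveW x e) _)
            (g := fun _ => g (Sum.inr w)), Finset.sum_const, nsmul_eq_mul]
        intro e he
        rw [P.mem_edges_inr.1 (Finset.mem_filter.1 he).1]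
    · rw [Finset.sum_eq_zero, Finset.sum_eq_zero]
      · intro e he
        rw [Finset.mem_filter, mem_edges] at he
        rcases v with f | w
        · obtain ⟨rfl, h2⟩ := he
          exact absurd h2.regular_inl hv
        · obtain ⟨rfl, h2⟩ := he
          exact absurd h2.1 hv
      · intro e he
        rw [Finset.mem_filter, mem_edges] at he
        rcases v with f | w
        · obtain ⟨rfl, h2⟩ := he
          exact absurd h2.1 hv
        · obtain ⟨rfl, h2⟩ := he
          exact absurd h2.regular_inr hv
  have hv₀L : v₀ ∈ L := by
    by_contra h
    exact hv₀ (hgL v₀ h)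
  have hv₀pos : 0 < g v₀ := lt_of_le_of_ne (hg0 v₀) hv₀.symm
  obtain ⟨e₀, he₀⟩ : ∃ e, ρ₀ e ≠ 0 := by
    obtain ⟨u, hu⟩ := (hL.regular hv₀L).exists_arc hx
    cases hu with
    | ofF e he => exact ⟨e, by simpa only [hρ₀, if_pos he] using hv₀⟩
    | ofW e he =>
      refine ⟨e, ?_⟩
      simp only [hρ₀]
      rw [if_neg fun h => h.not_activeW hx he, if_pos he]
      exact neg_ne_zero.2 hv₀
  obtain ⟨ρ, hρ, hgcd⟩ := Finset.extract_gcd ρ₀ (s := Finset.univ) ⟨e₀, Finset.mem_univ _⟩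
  set d := Finset.univ.gcd ρ₀ with hd
  have hd0 : 0 < d := by
    refine lt_of_le_of_ne ?_ fun h => ?_
    · have := Finset.normalize_gcd (s := (Finset.univ : Finset E)) (f := ρ₀)
      exact Int.nonneg_of_normalize_eq_self this
    · exact he₀ (Finset.gcd_eq_zero_iff.1 (hd.symm.trans h.symm) e₀ (Finset.mem_univ _))
  replace hρ : ∀ e, ρ₀ e = d * ρ e := fun e => hρ e (Finset.mem_univ _)
  have hneg : ∀ e, ρ e < 0 → ρ₀ e < 0 := fun e he => by rw [hρ]; exact mul_neg_of_pos_of_neg hd0 he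
  have hpos : ∀ e, 0 < ρ e → 0 < ρ₀ e := fun e he => by rw [hρ]; exact mul_pos hd0 he
  have hposF : ∀ e, 0 < ρ e → ρ₀ e = g (Sum.inl (P.fend e)) := by
    intro e he
    have h1 := hpos e he
    simp only [hρ₀] at h1 ⊢
    split_ifs at h1 ⊢ with h2 h3
    · rfl
    · linarith [hg0 (Sum.inr (P.wend e))]
    · exact absurd h1 (lt_irrefl _)
  have hnegW : ∀ e, ρ e < 0 → ρ₀ e = - g (Sum.inr (P.wend e)) := by
    intro e he
    have h1 := hneg e he
    simp only [hρ₀] at h1 ⊢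
    split_ifs at h1 ⊢ with h2 h3
    · linarith [hg0 (Sum.inl (P.fend e))]
    · rfl
    · exact absurd h1 (lt_irrefl _)
  have hcancel : ∀ e e', ρ₀ e = ρ₀ e' → ρ e = ρ e' := by
    intro e e' h
    rw [hρ, hρ] at h
    exact mul_left_cancel₀ hd0.ne' h
  refine ⟨ρ, ⟨?_, ?_⟩, ⟨?_, ?_⟩, hgcd, _, fun f => (g (Sum.inl f) : ℝ), fun w => (g (Sum.inr w) : ℝ),
    ?_, ⟨?_, ?_, rfl, ?_, ?_⟩, ?_, ?_, (d : ℝ)⁻¹, by positivity, ?_⟩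
  · rintro rfl
    exact he₀ (by simp [hρ])
  · intro v
    have := hsum v
    rw [Finset.sum_congr rfl fun e _ => hρ e, ← Finset.mul_sum] at this
    exact (mul_eq_zero.1 this).resolve_left hd0.ne'
  · intro e e' h h1 h2
    exact hcancel _ _ (by rw [hposF e h1, hposF e' h2, h])
  · intro e e' h h1 h2
    exact hcancel _ _ (by rw [hnegW e h1, hnegW e' h2, h])
  · have hF0 : ∀ f ∈ Finset.univ.filter (fun f => P.Regular x (Sum.inl f)),
        (0 : ℝ) ≤ ((P.potHead x f).card : ℝ) * (g (Sum.inl f) : ℝ) := fun f _ =>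
      mul_nonneg (Nat.cast_nonneg _) (by exact_mod_cast hg0 _)
    have hW0 : ∀ w ∈ Finset.univ.filter (fun w => P.Regular x (Sum.inr w)),
        (0 : ℝ) ≤ ((P.head x (Sum.inr w)).card : ℝ) * (g (Sum.inr w) : ℝ) := fun w _ =>
      mul_nonneg (Nat.cast_nonneg _) (by exact_mod_cast hg0 _)
    have hreg := hL.regular hv₀L
    obtain ⟨u, hu⟩ := hreg.exists_arc hx
    cases hu with
    | ofF e he =>
      refine add_pos_of_pos_of_nonneg (Finset.sum_pos' hF0 ⟨_, Finset.mem_filter.2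
        ⟨Finset.mem_univ _, hreg⟩, mul_pos ?_ (by exact_mod_cast hv₀pos)⟩) (Finset.sum_nonneg hW0)
      exact_mod_cast Finset.card_pos.2 ⟨e, he.2⟩
    | ofW e he =>
      refine add_pos_of_nonneg_of_pos (Finset.sum_nonneg hF0) (Finset.sum_pos' hW0 ⟨_,
        Finset.mem_filter.2 ⟨Finset.mem_univ _, hreg⟩, mul_pos ?_ (by exact_mod_cast hv₀pos)⟩)
      exact_mod_cast Finset.card_pos.2 ⟨e, he.2⟩
  · intro f hf
    rw [sub_eq_zero]
    exact_mod_cast hbalF f hf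
  · intro w hw
    rw [sub_eq_zero]
    exact_mod_cast hbalW w hw
  · intro f _
    exact_mod_cast hg0 _
  · intro f _
    exact_mod_cast hg0 _
  · intro f hf
    simp [hgL _ hf]
  · intro f hf
    simp [hgL _ hf]
  · intro e
    have h1 : (ρ₀ e : ℝ) = P.delta x (fun f => (g (Sum.inl f) : ℝ))
        (fun w => (g (Sum.inr w) : ℝ)) e := by
      simp only [hρ₀, delta]
      split_ifs <;> push_cast <;> rfl
    have h2 : (d : ℝ) ≠ 0 := by exact_mod_cast hd0.ne'
    rw [← h1, hρ e]
    push_cast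
    field_simp

end MixedProblem

namespace MixedProblem

variable {F W E : Type*} [Fintype E] {P : MixedProblem F W E}

open scoped Classical

/-! ### Shifts -/

variable (P) in
/-- The shift of `x` by `t ρ` stays nonnegative, does not exceed the bound `u` on the increasing edges,
and preserves the maximality of the heads within the critical ties of the workers. -/
structure SafeShift (x : E → ℝ) (ρ : E → ℤ) (u : E → ℝ) (t : ℝ) : Prop where
  t_nonneg : 0 ≤ t
  nonneg : ∀ e, 0 ≤ shift x t ρ e
  le_bound : ∀ e, 0 < ρ e → shift x t ρ e ≤ u e
  le_head : ∀ h e, h ∈ P.head x (Sum.inr (P.wend h)) → P.wend e = P.wend h →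
    P.rank (Sum.inr (P.wend h)) e = P.rank (Sum.inr (P.wend h)) h → shift x t ρ e ≤ shift x t ρ h

/-- The edges outside the tails of the workers. -/
noncomputable def nonTail (P : MixedProblem F W E) (x : E → ℝ) : Finset E :=
  Finset.univ.filter fun e => e ∉ P.tail x (Sum.inr (P.wend e))

/-- The edges that are outside the tails of the workers or have reached the bound `u`. -/
noncomputable def settled (P : MixedProblem F W E) (u x : E → ℝ) : Finset E :=
  Finset.univ.filter fun e => e ∉ P.tail x (Sum.inr (P.wend e)) ∨ u e ≤ x e

/-- The progress measure of a sequence of shifts. -/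
noncomputable def progress (P : MixedProblem F W E) (u x : E → ℝ) : ℕ :=
  (P.nonTail x).card + (P.settled u x).card

theorem progress_le (u x : E → ℝ) : P.progress u x ≤ 2 * Fintype.card E := by
  have h1 := Finset.card_le_univ (P.nonTail x)
  have h2 := Finset.card_le_univ (P.settled u x)
  unfold progress
  omega

theorem mem_nonTail {x : E → ℝ} {e : E} :
    e ∈ P.nonTail x ↔ e ∉ P.tail x (Sum.inr (P.wend e)) := by
  simp [nonTail]

theorem mem_settled {u x : E → ℝ} {e : E} :
    e ∈ P.settled u x ↔ e ∉ P.tail x (Sum.inr (P.wend e)) ∨ u e ≤ x e := by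
  simp [settled]

theorem shift_eq_of_eq_zero {E : Type*} {x : E → ℝ} {ρ : E → ℤ} {e : E} (h : ρ e = 0)
    (t : ℝ) : shift x t ρ e = x e := by
  simp [shift, h]

theorem le_of_mem_head {x : E → ℝ} (hx : ∀ e, 0 ≤ x e) {h e : E}
    (hh : h ∈ P.head x (Sum.inr (P.wend h))) (hw : P.wend e = P.wend h)
    (hr : P.rank (Sum.inr (P.wend h)) e = P.rank (Sum.inr (P.wend h)) h) : x e ≤ x h := by
  have hh' := (mem_head_iff fun e _ => hx e).1 hh
  rcases (hx e).eq_or_lt with h0 | h0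
  · exact h0 ▸ hx h
  · exact (hh'.2.2.2 e (by simpa using hw) h0).2 hr

theorem SafeShift.le_b {x : E → ℝ} {ρ : E → ℤ} {u : E → ℝ} (hxb : ∀ e, x e ≤ P.b e) (hu : ∀ e, u e ≤ P.b e) {t : ℝ}
    (ht : P.SafeShift x ρ u t) (e : E) : shift x t ρ e ≤ P.b e := by
  rcases lt_or_ge 0 (ρ e) with h | h
  · exact (ht.le_bound e h).trans (hu e)
  · have h2 : t * (ρ e : ℝ) ≤ 0 :=
      mul_nonpos_of_nonneg_of_nonpos ht.t_nonneg (by exact_mod_cast h)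
    have := hxb e
    simp only [shift]
    linarith

/-! ### Monotonicity, maximal weight and stability of safe shifts -/

namespace IsShiftDirection

variable {x : E → ℝ} {ρ : E → ℤ} (hρ : P.IsShiftDirection x ρ)
include hρ

theorem total_shift (t : ℝ) (v : F ⊕ W) : P.total v (shift x t ρ) = P.total v x := by
  have h1 : ∑ e ∈ P.edges v, (ρ e : ℝ) = 0 := by exact_mod_cast hρ.sum_eq_zero v
  simp only [total, shift, Finset.sum_add_distrib, ← Finset.mul_sum, h1, mul_zero, add_zero]

theorem filled_shift_iff (t : ℝ) (v : F ⊕ W) : P.Filled (shift x t ρ) v ↔ P.Filled x v := by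
  rw [Filled, Filled, hρ.total_shift]

theorem eq_zero_of_not_regular_inr {e : E} (he : ¬ P.Regular x (Sum.inr (P.wend e))) :
    ρ e = 0 := by
  rcases lt_trichotomy (ρ e) 0 with h | h | h
  · exact absurd (hρ.activeW e h).1 he
  · exact h
  · exact absurd (hρ.activeF e h).regular_inr he

/-- The support of a worker cannot spread past the old critical tie: an edge that enters it is
active for `F`, hence was in the tail. -/
theorem rank_le_head (hx : ∀ e, 0 ≤ x e) {t : ℝ} (ht : 0 ≤ t) {w : W} {h e : E}
    (hh : h ∈ P.head x (Sum.inr w)) (he : P.wend e = w) (hpos : 0 < shift x t ρ e) :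
    P.rank (Sum.inr w) e ≤ P.rank (Sum.inr w) h := by
  have hh' := (mem_head_iff fun e _ => hx e).1 hh
  rcases (hx e).eq_or_lt with h0 | h0
  · have h1 : 0 < ρ e := by
      by_contra! h1
      have h2 : t * (ρ e : ℝ) ≤ 0 := mul_nonpos_of_nonneg_of_nonpos ht (by exact_mod_cast h1)
      simp only [shift, ← h0] at hpos
      linarith
    subst he
    obtain ⟨a, ha, hpos', h2⟩ := ((mem_tail_iff fun e _ => hx e).1 (hρ.activeF e h1).mem_tail).2 hh'.1
    have h3 := (hh'.2.2.2 a ha hpos').1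
    omega
  · exact (hh'.2.2.2 e (by simpa using he) h0).1

/-- By `rank_le_head`, an edge pushing `e` into the tail must share the old critical tie with it.
Then `e` is in the head of `x`, and `le_head` forbids being overtaken. -/
theorem notMem_tail_shift (hx : ∀ e, 0 ≤ x e) {u : E → ℝ} {t : ℝ} (ht : P.SafeShift x ρ u t) {e : E}
    (he : e ∉ P.tail x (Sum.inr (P.wend e))) : e ∉ P.tail (shift x t ρ) (Sum.inr (P.wend e)) := by
  intro he'
  have hf := filled_of_notMem_tail (by simp) he
  obtain ⟨a, ha, hpos, h1⟩ := ((mem_tail_iff fun e _ => ht.nonneg e).1 he').2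
    ((hρ.filled_shift_iff _ _).2 hf)
  obtain ⟨h, hh⟩ := exists_mem_head (fun e _ => hx e) hf
  have hh' := (mem_head_iff fun e _ => hx e).1 hh
  have h2 := hρ.rank_le_head hx ht.t_nonneg hh (by simpa using ha) hpos
  have h3 := rank_le_of_notMem_tail (fun e _ => hx e) (by simp) he hh'.2.1 hh'.2.2.1
  have h4 := h1.resolve_left (by omega)
  have h5 : 0 < x e := hh'.2.2.1.trans_le (h3.2 (by omega))
  have h6 : e ∈ P.head x (Sum.inr (P.wend e)) :=
    (mem_head_iff_notMem_tail fun e _ => hx e).2 ⟨by simp, h5, he⟩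
  exact (ht.le_head e a h6 (by simpa using ha) h4.1.symm).not_gt h4.2

/-- The two alternatives of admissibility correspond to the shifted value of a head edge being
positive or zero: it dominates its tie, so at zero the whole critical tie vanishes. -/
theorem admissible_of_safeShift (hx : ∀ e, 0 ≤ x e) {u : E → ℝ} (hxb : ∀ e, x e ≤ P.b e)
    (hu : ∀ e, u e ≤ P.b e) {t : ℝ} (ht : P.SafeShift x ρ u t) : P.Admissible x ρ t := by
  refine ⟨ht.t_nonneg, fun e => ⟨ht.nonneg e, ht.le_b hxb hu e⟩, fun w hw => ?_⟩
  obtain ⟨h, hh⟩ := exists_mem_head (fun e _ => hx e) hw.1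
  have hh' := (mem_head_iff fun e _ => hx e).1 hh
  have hwh : P.wend h = w := by simpa using hh'.2.1
  have hf : P.Filled (shift x t ρ) (Sum.inr w) := (hρ.filled_shift_iff _ _).2 hw.1
  have hcrit : ∀ e, e ∈ P.critTie x (Sum.inr w) ↔
      P.wend e = w ∧ P.rank (Sum.inr w) e = P.rank (Sum.inr w) h := by
    intro e
    rw [mem_critTie_iff (fun e _ => hx e) hw.1, mem_edges_inr]
    refine and_congr_right fun _ => ⟨?_, ?_⟩
    · rintro ⟨h1, a, h2, h3, h4⟩
      exact le_antisymm (h4 ▸ (hh'.2.2.2 a h2 h3).1) (h1 h hh'.2.1 hh'.2.2.1)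
    · intro h1
      exact ⟨fun a ha hpos => h1 ▸ (hh'.2.2.2 a ha hpos).1, h, hh'.2.1, hh'.2.2.1, h1.symm⟩
  rcases (ht.nonneg h).eq_or_lt with h0 | h0
  · right
    intro e he
    obtain ⟨h1, h2⟩ := (hcrit e).1 he
    subst hwh
    exact le_antisymm (h0 ▸ ht.le_head h e hh h1 h2) (ht.nonneg e)
  · left
    have hcrit' : ∀ e, e ∈ P.critTie (shift x t ρ) (Sum.inr w) ↔
        P.wend e = w ∧ P.rank (Sum.inr w) e = P.rank (Sum.inr w) h := by
      intro e
      rw [mem_critTie_iff (fun e _ => ht.nonneg e) hf, mem_edges_inr]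
      refine and_congr_right fun _ => ⟨?_, ?_⟩
      · rintro ⟨h1, a, h2, h3, h4⟩
        exact le_antisymm (h4 ▸ hρ.rank_le_head hx ht.t_nonneg hh (by simpa using h2) h3)
          (h1 h hh'.2.1 h0)
      · intro h1
        exact ⟨fun a ha hpos => h1 ▸ hρ.rank_le_head hx ht.t_nonneg hh (by simpa using ha) hpos,
          h, hh'.2.1, h0, h1.symm⟩
    refine ⟨Finset.ext fun e => (hcrit' e).trans (hcrit e).symm, fun e he => ?_⟩
    have he' : P.wend e = w := by simpa using ((mem_head_iff fun e _ => hx e).1 he).2.1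
    subst he'
    have h1 := (mem_head_iff_notMem_tail fun e _ => hx e).1 he
    rw [mem_head_iff_notMem_tail fun e _ => ht.nonneg e]
    refine ⟨by simp, ?_, hρ.notMem_tail_shift hx ht h1.2.2⟩
    refine h0.trans_le (ht.le_head e h he hwh ?_)
    have h2 := rank_le_of_notMem_tail (fun e _ => hx e) h1.1 h1.2.2 hh'.2.1 hh'.2.2.1
    exact le_antisymm h2.1 (hh'.2.2.2 e h1.1 h1.2.1).1

theorem safeShift_of_admissible (hx : ∀ e, 0 ≤ x e) {t : ℝ} (ht : P.Admissible x ρ t) :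
    P.SafeShift x ρ P.b t := by
  refine ⟨ht.1, fun e => (ht.2.1 e).1, fun e _ => (ht.2.1 e).2, fun h e hh hw hr => ?_⟩
  have hh' := (mem_head_iff fun e _ => hx e).1 hh
  by_cases hreg : P.Regular x (Sum.inr (P.wend h))
  · have hc : e ∈ P.critTie x (Sum.inr (P.wend h)) := by
      rw [mem_critTie_iff (fun e _ => hx e) hh'.1]
      exact ⟨by simpa using hw, fun a ha hpos => hr ▸ (hh'.2.2.2 a ha hpos).1, h, hh'.2.1,
        hh'.2.2.1, hr.symm⟩
    rcases ht.2.2 _ hreg with ⟨h1, h2⟩ | h1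
    · have h3 := h2 hh
      rw [head, if_pos ((hρ.filled_shift_iff _ _).2 hreg.1), Finset.mem_filter] at h3
      exact h3.2 e (h1 ▸ hc)
    · rw [h1 e hc]
      exact (ht.2.1 h).1
  · rw [shift_eq_of_eq_zero (hρ.eq_zero_of_not_regular_inr hreg),
      shift_eq_of_eq_zero (hρ.eq_zero_of_not_regular_inr (by rwa [hw]))]
    exact le_of_mem_head hx hh hw hr

theorem nonTail_subset (hx : ∀ e, 0 ≤ x e) {u : E → ℝ} {t : ℝ} (ht : P.SafeShift x ρ u t) :
    P.nonTail x ⊆ P.nonTail (shift x t ρ) := fun _ he =>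
  mem_nonTail.2 (hρ.notMem_tail_shift hx ht (mem_nonTail.1 he))

/-- A tail edge at its bound does not move: increasing edges start strictly below the bound, and
decreasing ones lie outside the tail. -/
theorem settled_subset (hx : ∀ e, 0 ≤ x e) {u : E → ℝ} (hxu : ∀ e, 0 < ρ e → x e < u e) {t : ℝ}
    (ht : P.SafeShift x ρ u t) : P.settled u x ⊆ P.settled u (shift x t ρ) := by
  intro e he
  rw [mem_settled] at he ⊢
  by_cases hT : e ∈ P.tail x (Sum.inr (P.wend e))
  · right
    have h1 := he.resolve_left (not_not.2 hT)
    rcases lt_trichotomy (ρ e) 0 with h | h | h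
    · exact absurd hT ((activeW_iff hx).1 (hρ.activeW e h)).2.2
    · rwa [shift_eq_of_eq_zero h]
    · exact absurd (hxu e h) h1.not_gt
  · exact Or.inl (hρ.notMem_tail_shift hx ht hT)

/-- A safe shift without progress can be prolonged. -/
theorem exists_gt_safeShift (hx : ∀ e, 0 ≤ x e) {u : E → ℝ}
    (hxu : ∀ e, 0 < ρ e → x e < u e) {t : ℝ} (ht : P.SafeShift x ρ u t)
    (hprog : P.progress u (shift x t ρ) ≤ P.progress u x) : ∃ s, t < s ∧ P.SafeShift x ρ u s := by
  have hsub1 := hρ.nonTail_subset hx ht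
  have hsub2 := hρ.settled_subset hx hxu ht
  have hc1 := Finset.card_le_card hsub1
  have hc2 := Finset.card_le_card hsub2
  unfold progress at hprog
  have heq1 := Finset.eq_of_subset_of_card_le hsub1 (by omega)
  have heq2 := Finset.eq_of_subset_of_card_le hsub2 (by omega)
  have htail : ∀ e, e ∈ P.tail (shift x t ρ) (Sum.inr (P.wend e)) ↔
      e ∈ P.tail x (Sum.inr (P.wend e)) := by
    intro e
    have := Finset.ext_iff.1 heq1 e
    rw [mem_nonTail, mem_nonTail] at this
    tauto
  have hlt : ∀ e, 0 < ρ e → shift x t ρ e < u e := by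
    intro e he
    by_contra! h1
    have h2 : e ∈ P.settled u x := by
      rw [heq2, mem_settled]
      exact Or.inr h1
    rw [mem_settled] at h2
    rcases h2 with h2 | h2
    · exact h2 (hρ.activeF e he).mem_tail
    · exact h2.not_gt (hxu e he)
  -- With tails unchanged, a head edge after the shift was outside the tail before, so it lies in
  -- the old critical tie and its positive value is dominated by that of `h`.
  have hhead : ∀ h, h ∈ P.head x (Sum.inr (P.wend h)) → 0 < shift x t ρ h := by
    intro h hh
    have hh' := (mem_head_iff fun e _ => hx e).1 hh
    obtain ⟨a, ha⟩ := exists_mem_head (fun e _ => ht.nonneg e) ((hρ.filled_shift_iff t _).2 hh'.1)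
    have ha' := (mem_head_iff_notMem_tail fun e _ => ht.nonneg e).1 ha
    have haw : P.wend a = P.wend h := by simpa using ha'.1
    have haT : a ∉ P.tail x (Sum.inr (P.wend a)) := by
      rw [← htail, haw]
      exact ha'.2.2
    refine ha'.2.1.trans_le ?_
    refine ht.le_head h a hh haw ?_
    have h1 := hρ.rank_le_head hx ht.t_nonneg hh haw ha'.2.1
    rw [haw] at haT
    have h2 := rank_le_of_notMem_tail (fun e _ => hx e) (by simpa using haw) haT hh'.2.1 hh'.2.2.1
    exact le_antisymm h1 h2.1
  -- Every constraint is now either strict at `t`, and survives slightly beyond it by continuity, or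
  -- holds identically in the weight.
  have hcont : ∀ e, Continuous fun s => shift x s ρ e := by
    intro e
    simp only [shift]
    fun_prop
  have hev1 : ∀ᶠ s in nhds t, ∀ e, ρ e < 0 → 0 < shift x s ρ e := by
    rw [Filter.eventually_all]
    intro e
    by_cases h1 : ρ e < 0
    · filter_upwards [(hcont e).continuousAt.eventually (lt_mem_nhds
        (hhead e (hρ.activeW e h1).2))] with s hs _ using hs
    · exact Filter.Eventually.of_forall fun s h => absurd h h1
  have hev2 : ∀ᶠ s in nhds t, ∀ e, 0 < ρ e → shift x s ρ e < u e := by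
    rw [Filter.eventually_all]
    intro e
    by_cases h1 : 0 < ρ e
    · filter_upwards [(hcont e).continuousAt.eventually (gt_mem_nhds (hlt e h1))] with s hs _ using hs
    · exact Filter.Eventually.of_forall fun s h => absurd h h1
  have hev3 : ∀ᶠ s in nhds t, ∀ h e, h ∈ P.head x (Sum.inr (P.wend h)) → P.wend e = P.wend h →
      P.rank (Sum.inr (P.wend h)) e = P.rank (Sum.inr (P.wend h)) h →
        shift x s ρ e ≤ shift x s ρ h := by
    rw [Filter.eventually_all]
    intro h
    rw [Filter.eventually_all]
    intro e
    by_cases h1 : h ∈ P.head x (Sum.inr (P.wend h)) ∧ P.wend e = P.wend h ∧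
        P.rank (Sum.inr (P.wend h)) e = P.rank (Sum.inr (P.wend h)) h
    · obtain ⟨hh, hw, hr⟩ := h1
      have hh' := (mem_head_iff_notMem_tail fun e _ => hx e).1 hh
      by_cases heT : e ∈ P.tail x (Sum.inr (P.wend e))
      · have h2 : shift x t ρ e < shift x t ρ h := by
          rw [← htail, mem_tail_iff fun e _ => ht.nonneg e, hw] at heT
          obtain ⟨a, ha, hpos, h3⟩ := heT.2 ((hρ.filled_shift_iff _ _).2
            (filled_of_notMem_tail hh'.1 hh'.2.2))
          have h4 : h ∉ P.tail (shift x t ρ) (Sum.inr (P.wend h)) := by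
            rw [htail]; exact hh'.2.2
          have h5 := rank_le_of_notMem_tail (fun e _ => ht.nonneg e) hh'.1 h4 ha hpos
          have h6 := h3.resolve_left (by omega)
          exact h6.2.trans_le (h5.2 (by omega))
        filter_upwards [((hcont e).continuousAt).eventually_lt (hcont h).continuousAt h2] with
          s hs _ _ _ using hs.le
      -- Here `e` is itself a head edge, equal to `h` in value, and alignment moves both at the same
      -- speed.
      · have h2 := rank_le_of_notMem_tail (fun e _ => hx e) (by simpa using hw) (hw ▸ heT) hh'.1
          hh'.2.1
        have h3 := h2.2 hr.symm
        have h4 : x e = x h := le_antisymm (le_of_mem_head hx hh hw hr) h3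
        have h5 : ρ e = ρ h := by
          by_cases hreg : P.Regular x (Sum.inr (P.wend h))
          · refine hρ.eq_of_activeW e h hw ?_ ⟨hreg, hh⟩
            rw [activeW_iff hx, h4, hw]
            exact ⟨hreg, hh'.2.1, hw ▸ heT⟩
          · rw [hρ.eq_zero_of_not_regular_inr hreg, hρ.eq_zero_of_not_regular_inr (by rwa [hw])]
        exact Filter.Eventually.of_forall fun s _ _ _ => by simp only [shift, h4, h5, le_refl]
    · exact Filter.Eventually.of_forall fun s h2 h3 h4 => absurd ⟨h2, h3, h4⟩ h1
  have hev := ((hev1.and (hev2.and hev3)).filter_mono nhdsWithin_le_nhds).and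
    (self_mem_nhdsWithin : Set.Ioi t ∈ nhdsWithin t (Set.Ioi t))
  obtain ⟨s, ⟨h1, h2, h3⟩, hs⟩ := hev.exists
  have hs' : t < s := hs
  refine ⟨s, hs', ht.t_nonneg.trans hs'.le, fun e => ?_, fun e he => (h2 e he).le, h3⟩
  rcases lt_or_ge (ρ e) 0 with h | h
  · exact (h1 e h).le
  · have h4 : 0 ≤ s * (ρ e : ℝ) :=
      mul_nonneg (ht.t_nonneg.trans hs'.le) (by exact_mod_cast h)
    have := hx e
    simp only [shift]
    linarith

/-- There is a largest safe shift. -/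
theorem exists_isGreatest_safeShift (hx : ∀ e, 0 ≤ x e) {u : E → ℝ}
    (hxu : ∀ e, 0 < ρ e → x e < u e) : ∃ t, IsGreatest {s | P.SafeShift x ρ u s} t := by
  have h0 : P.SafeShift x ρ u 0 := by
    have h1 : ∀ e, shift x 0 ρ e = x e := fun e => by simp [shift]
    refine ⟨le_rfl, fun e => ?_, fun e he => ?_, fun h e hh hw hr => ?_⟩
    · rw [h1]; exact hx e
    · rw [h1]; exact (hxu e he).le
    · rw [h1, h1]; exact le_of_mem_head hx hh hw hr
  have hbdd : BddAbove {s | P.SafeShift x ρ u s} := by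
    obtain ⟨e, he⟩ : ∃ e, ρ e ≠ 0 := Function.ne_iff.1 hρ.ne_zero
    rcases lt_or_gt_of_ne he with h | h
    · refine ⟨x e / (-(ρ e : ℝ)), fun s hs => ?_⟩
      have h1 : (0 : ℝ) < -(ρ e : ℝ) := by
        have : (ρ e : ℝ) < 0 := by exact_mod_cast h
        linarith
      rw [le_div_iff₀ h1]
      have := hs.nonneg e
      simp only [shift] at this
      linarith
    · refine ⟨(u e - x e) / (ρ e : ℝ), fun s hs => ?_⟩
      have h1 : (0 : ℝ) < ρ e := by exact_mod_cast h
      rw [le_div_iff₀ h1]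
      have := hs.le_bound e h
      simp only [shift] at this
      linarith
  have hcont : ∀ e, Continuous fun s => shift x s ρ e := by
    intro e
    simp only [shift]
    fun_prop
  have hclosed : IsClosed {s | P.SafeShift x ρ u s} := by
    have h1 : {s | P.SafeShift x ρ u s} = {s | 0 ≤ s} ∩ (⋂ e, {s | 0 ≤ shift x s ρ e}) ∩
        (⋂ e, ⋂ (_ : 0 < ρ e), {s | shift x s ρ e ≤ u e}) ∩
        (⋂ h, ⋂ e, ⋂ (_ : h ∈ P.head x (Sum.inr (P.wend h))), ⋂ (_ : P.wend e = P.wend h),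
          ⋂ (_ : P.rank (Sum.inr (P.wend h)) e = P.rank (Sum.inr (P.wend h)) h),
            {s | shift x s ρ e ≤ shift x s ρ h}) := by
      ext s
      simp only [Set.mem_inter_iff, Set.mem_iInter, Set.mem_ofPred_eq]
      exact ⟨fun h => ⟨⟨⟨h.1, h.2⟩, h.3⟩, h.4⟩, fun h => ⟨h.1.1.1, h.1.1.2, h.1.2, h.2⟩⟩
    rw [h1]
    refine ((isClosed_Ici.inter (isClosed_iInter fun e => ?_)).inter
      (isClosed_iInter fun e => isClosed_iInter fun _ => ?_)).inter
      (isClosed_iInter fun h => isClosed_iInter fun e => isClosed_iInter fun _ =>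
        isClosed_iInter fun _ => isClosed_iInter fun _ => ?_)
    · exact isClosed_le continuous_const (hcont e)
    · exact isClosed_le (hcont e) continuous_const
    · exact isClosed_le (hcont e) (hcont h)
  exact ⟨_, hclosed.csSup_mem ⟨0, h0⟩ hbdd, fun s hs => le_csSup hbdd hs⟩

theorem progress_lt_of_isGreatest (hx : ∀ e, 0 ≤ x e) {u : E → ℝ}
    (hxu : ∀ e, 0 < ρ e → x e < u e) {t : ℝ} (ht : IsGreatest {s | P.SafeShift x ρ u s} t) :
    P.progress u x < P.progress u (shift x t ρ) := by
  by_contra! h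
  obtain ⟨s, hs, hs'⟩ := hρ.exists_gt_safeShift hx hxu ht.1 h
  exact (ht.2 hs').not_gt hs

/-- Safe shifts of positive weight preserve stability. -/
theorem stable_shift (hx : P.Stable x) {u : E → ℝ} (hu : ∀ e, u e ≤ P.b e) {t : ℝ}
    (ht : P.SafeShift x ρ u t) (htpos : 0 < t) : P.Stable (shift x t ρ) := by
  have htR : ∀ e, ρ e ≤ 0 → shift x t ρ e ≤ x e := by
    intro e he
    have h2 : t * (ρ e : ℝ) ≤ 0 :=
      mul_nonpos_of_nonneg_of_nonpos ht.t_nonneg (by exact_mod_cast he)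
    simp only [shift]
    linarith
  rw [stable_iff]
  refine ⟨fun e => ⟨ht.nonneg e, ht.le_b hx.le_b hu e⟩,
    fun v => (hρ.total_shift t v).trans_le (hx.total_le v), fun e heb heF heW => ?_⟩
  have heW' : e ∈ P.tail x (Sum.inr (P.wend e)) := by
    by_contra h
    exact hρ.notMem_tail_shift hx.nonneg ht h heW
  have hρe : 0 ≤ ρ e := by
    by_contra! h
    exact ((activeW_iff hx.nonneg).1 (hρ.activeW e h)).2.2 heW'
  have heb' : x e < P.b e := by
    have h1 : 0 ≤ t * (ρ e : ℝ) := mul_nonneg ht.t_nonneg (by exact_mod_cast hρe)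
    simp only [shift] at heb
    linarith
  have heF' : e ∉ P.tail x (Sum.inl (P.fend e)) := fun h => hx.notMem_tail heb' h heW'
  by_cases hex : ∃ d, P.fend d = P.fend e ∧ 0 < ρ d
  · obtain ⟨d, hde, hdpos⟩ := hex
    have hd := hρ.activeF d hdpos
    have hd2 := mem_potHead_iff.1 hd.2
    have hd3 := mem_potential_iff.1 hd2.2.1
    rw [hde] at hd2 hd3
    have hdF : d ∉ P.tail x (Sum.inl (P.fend e)) := by
      rw [← hde]
      exact fun h => hx.notMem_tail hd.lt_b h hd.mem_tail
    have hdx' : x d < shift x t ρ d := by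
      have h1 : 0 < t * (ρ d : ℝ) := mul_pos htpos (by exact_mod_cast hdpos)
      simp only [shift]
      linarith
    have hdshift : 0 < shift x t ρ d := (hx.nonneg d).trans_lt hdx'
    -- the support of the shifted assignment at the firm ends with the potential head
    have hsupp : ∀ a, P.fend a = P.fend e → 0 < shift x t ρ a →
        P.rank (Sum.inl (P.fend e)) a ≤ P.rank (Sum.inl (P.fend e)) d ∧
        (P.rank (Sum.inl (P.fend e)) a = P.rank (Sum.inl (P.fend e)) d →
          shift x t ρ a ≤ shift x t ρ d) := by
      intro a ha hpos
      rcases lt_or_ge 0 (ρ a) with h | h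
      · have h1 := hρ.activeF a h
        have h2 := mem_potHead_iff.1 h1.2
        rw [ha] at h2
        refine ⟨h2.2.2 d hd2.2.1, fun _ => ?_⟩
        have h3 := hρ.eq_of_activeF a d (ha.trans hde.symm) h1 hd
        have h4 : a ∉ P.tail x (Sum.inl (P.fend e)) := by
          rw [← ha]
          exact fun h => hx.notMem_tail h1.lt_b h h1.mem_tail
        have h5 : x a ≤ x d := by
          rcases (hx.nonneg a).eq_or_lt with h0 | h0
          · exact h0 ▸ hx.nonneg d
          · exact (rank_le_of_notMem_tail (fun e _ => hx.nonneg e) (by simpa using hde) hdF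
              (by simpa using ha) h0).2 (le_antisymm (h2.2.2 d hd2.2.1) (hd2.2.2 a h2.2.1))
        simp only [shift, h3]
        linarith
      · have h1 := htR a h
        have h2 := rank_le_of_notMem_tail (fun e _ => hx.nonneg e) (by simpa using hde) hdF
          (by simpa using ha) (hpos.trans_le h1)
        exact ⟨h2.1, fun h3 => h1.trans ((h2.2 h3).trans hdx'.le)⟩
    obtain ⟨a, ha, hpos, h1⟩ := ((mem_tail_iff fun e _ => ht.nonneg e).1 heF).2
      ((hρ.filled_shift_iff _ _).2 hd2.1)
    have h2 := hsupp a (by simpa using ha) hpos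
    -- The support now ends at the tie of `d`, so `e` is no worse than `d` and inherits the absence
    -- of deficit workers. Minimality of `d` puts both in `D_f`: they move together, and `e` cannot
    -- fall behind.
    have hpot : e ∈ P.potential x (P.fend e) := by
      refine mem_potential_iff.2 ⟨rfl, ⟨heb', heW'⟩, fun e' he' hr hb => ?_⟩
      exact hd3.2.2 e' he' (by omega) hb
    have h3 := hd2.2.2 e hpot
    have h4 := h1.resolve_left (by omega)
    have heA : P.ActiveF x e := by
      refine ⟨hde ▸ hd.1, mem_potHead_iff.2 ⟨hd2.1, hpot, fun e' he' => ?_⟩⟩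
      have := hd2.2.2 e' he'
      omega
    have h5 := hρ.eq_of_activeF e d hde.symm heA hd
    have h6 : x d ≤ x e := by
      rcases (hx.nonneg d).eq_or_lt with h0 | h0
      · exact h0 ▸ hx.nonneg e
      · exact (rank_le_of_notMem_tail (fun e _ => hx.nonneg e) (by simp) heF'
          (by simpa using hde) h0).2 (by omega)
    have h7 : shift x t ρ d ≤ shift x t ρ e := by
      simp only [shift, h5]
      linarith
    exact (h4.2.trans_le (h2.2 (by omega))).not_ge h7
  · push Not at hex
    have h1 : ∀ a ∈ P.edges (Sum.inl (P.fend e)), ρ a = 0 :=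
      (Finset.sum_eq_zero_iff_of_nonpos fun a ha => hex a (by simpa using ha)).1
        (hρ.sum_eq_zero _)
    have h2 : ∀ a ∈ P.edges (Sum.inl (P.fend e)), shift x t ρ a = x a := fun a ha =>
      shift_eq_of_eq_zero (h1 a ha) t
    refine heF' ?_
    rw [mem_tail_iff fun e _ => ht.nonneg e, hρ.filled_shift_iff] at heF
    rw [mem_tail_iff fun e _ => hx.nonneg e]
    refine ⟨heF.1, fun hf => ?_⟩
    obtain ⟨a, ha, h3⟩ := heF.2 hf
    rw [h2 a ha, h2 e heF.1] at h3
    exact ⟨a, ha, h3⟩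

end IsShiftDirection

end MixedProblem

namespace MixedProblem

variable {F W E : Type*} [Fintype F] [Fintype W] [Fintype E] {P : MixedProblem F W E}

open scoped Classical

/-! ### Sequences of rotational shifts -/

/-- Only the box constraints are needed here, and admissibility returns them, so stability need not
be carried along the sequence. -/
theorem IsFullRotShift.progress_lt {x y : E → ℝ} (hx : ∀ e, 0 ≤ x e ∧ x e ≤ P.b e)
    (h : P.IsFullRotShift x y) :
    P.progress P.b x < P.progress P.b y ∧ ∀ e, 0 ≤ y e ∧ y e ≤ P.b e := by
  obtain ⟨L, ρ, t, -, hrot, ht, rfl⟩ := h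
  have hx0 : ∀ e, 0 ≤ x e := fun e => (hx e).1
  have hρ := (hrot.isShiftDirection hx0).1
  refine ⟨hρ.progress_lt_of_isGreatest hx0 (fun e he => (hρ.activeF e he).lt_b)
    ⟨hρ.safeShift_of_admissible hx0 ht.1, fun s hs => ht.2 ?_⟩, ht.1.2.1⟩
  exact hρ.admissible_of_safeShift hx0 (fun e => (hx e).2) (fun _ => le_rfl) hs

theorem le_of_isFullRotShift_sequence {x : ℕ → E → ℝ} {N : ℕ} (h0 : P.Stable (x 0))
    (h : ∀ i < N, P.IsFullRotShift (x i) (x (i + 1))) : N ≤ 2 * Fintype.card E := by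
  have key : ∀ i ≤ N, i ≤ P.progress P.b (x i) ∧ ∀ e, 0 ≤ x i e ∧ x i e ≤ P.b e := by
    intro i
    induction i with
    | zero => exact fun _ => ⟨Nat.zero_le _, (stable_iff.1 h0).1⟩
    | succ i ih =>
      intro hi
      obtain ⟨h1, h2⟩ := ih (by omega)
      obtain ⟨h3, h4⟩ := (h i (by omega)).progress_lt h2
      exact ⟨by omega, h4⟩
  exact (key N le_rfl).1.trans (progress_le _ _)

/-- The bound on the increasing edges of shifts towards `y`. -/
noncomputable def targetBound (P : MixedProblem F W E) (y : E → ℝ) (e : E) : ℝ :=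
  if e ∈ P.tail y (Sum.inr (P.wend e)) then y e else P.b e

theorem StablePair.exists_isRotShift {x y : E → ℝ} (h : P.StablePair x y) (hne : x ≠ y) :
    ∃ x', P.IsRotShift x x' ∧ P.StablePair x' y ∧
      P.progress (P.targetBound y) x < P.progress (P.targetBound y) x' := by
  have hx := h.left.nonneg
  obtain ⟨e₀, he₀⟩ := Function.ne_iff.1 hne
  obtain ⟨L, hLD, hL⟩ := exists_isMaxComponent (D := {v | P.DiffersAt x y v}) hx
    ⟨Sum.inl (P.fend e₀), e₀, by simp, he₀⟩ (fun v hv => h.regular_of_differsAt hv)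
    fun u hu v huv => h.differsAt_of_arc hu huv
  obtain ⟨ρ, hrot⟩ := hL.exists_isRotation hx
  obtain ⟨hρ, hρL⟩ := hrot.isShiftDirection hx
  have hu : ∀ e, P.targetBound y e ≤ P.b e := by
    intro e
    unfold targetBound
    split_ifs
    · exact h.right.le_b e
    · exact le_rfl
  -- Increasing edges leave firms of `L`, where `x` and `y` differ, so those in the worker tails of
  -- `y` still have room to grow towards `y`.
  have hxu : ∀ e, 0 < ρ e → x e < P.targetBound y e := by
    intro e he
    have h1 := hρ.activeF e he
    unfold targetBound
    split_ifs with h2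
    · exact h.lt_of_mem_potHead (hLD (hρL e he)) h1.2 h2
    · exact h1.lt_b
  obtain ⟨t, ht⟩ := hρ.exists_isGreatest_safeShift hx hxu
  have hprog := hρ.progress_lt_of_isGreatest hx hxu ht
  have htpos : 0 < t := by
    refine lt_of_le_of_ne ht.1.t_nonneg ?_
    rintro rfl
    have h1 : shift x 0 ρ = x := by funext e; simp [shift]
    rw [h1] at hprog
    exact hprog.false
  refine ⟨shift x t ρ, ⟨L, ρ, t, hL, hrot, htpos,
    hρ.admissible_of_safeShift hx h.left.le_b hu ht.1, rfl⟩,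
    ⟨hρ.stable_shift h.left hu ht.1 htpos, h.right, fun w e he => ?_⟩, hprog⟩
  have hw : P.wend e = w := by
    simpa using ((mem_tail_iff fun e _ => h.right.nonneg e).1 he).1
  subst hw
  -- `targetBound` was chosen for this: on the worker tails of `y`, increasing edges are capped by
  -- `y`, and the other edges were already below it.
  rcases lt_or_ge 0 (ρ e) with h1 | h1
  · have h2 := ht.1.le_bound e h1
    rwa [targetBound, if_pos he] at h2
  · have h2 : t * (ρ e : ℝ) ≤ 0 :=
      mul_nonpos_of_nonneg_of_nonpos htpos.le (by exact_mod_cast h1)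
    have h3 := h.le_inr _ e he
    simp only [shift]
    linarith

theorem StablePair.exists_sequence {x y : E → ℝ} (h : P.StablePair x y) :
    ∃ (N : ℕ) (z : ℕ → E → ℝ), N + P.progress (P.targetBound y) x ≤ 2 * Fintype.card E ∧
      z 0 = x ∧ z N = y ∧ (∀ i ≤ N, P.Stable (z i)) ∧
        ∀ i < N, P.IsRotShift (z i) (z (i + 1)) := by
  induction hn : 2 * Fintype.card E - P.progress (P.targetBound y) x using Nat.strong_induction_on
    generalizing x with
  | _ n ih =>
    by_cases hne : x = y
    · exact ⟨0, fun _ => x, by simpa using progress_le _ _, rfl, hne, fun _ _ => h.left,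
        fun i hi => absurd hi (Nat.not_lt_zero i)⟩
    · obtain ⟨x', h1, h2, h3⟩ := h.exists_isRotShift hne
      have h4 := progress_le (P := P) (P.targetBound y) x'
      obtain ⟨N, z, hN, hz0, hzN, hst, hrot⟩ := ih _ (by omega) h2 rfl
      refine ⟨N + 1, fun i => Nat.casesOn i x z, by omega, rfl, hzN, ?_, ?_⟩
      · rintro (_ | i) hi
        · exact h.left
        · exact hst i (by omega)
      · rintro (_ | i) hi
        · change P.IsRotShift x (z 0)
          rwa [hz0]
        · exact hrot i (by omega)

end MixedProblem

theorem mainTheorem7 {F W E : Type*} [Fintype F] [Fintype W] [Fintype E]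
    (P : MixedProblem F W E) :
    (∀ (N : ℕ) (x : ℕ → E → ℝ), P.Stable (x 0) →
      (∀ i < N, P.IsFullRotShift (x i) (x (i + 1))) → N ≤ 2 * Fintype.card E) ∧
    (∀ xmin : E → ℝ, P.IsXmin xmin → ∀ y : E → ℝ, P.Stable y →
      ∃ (N : ℕ) (x : ℕ → E → ℝ), N ≤ 2 * Fintype.card E ∧ x 0 = xmin ∧ x N = y ∧
        (∀ i ≤ N, P.Stable (x i)) ∧ ∀ i < N, P.IsRotShift (x i) (x (i + 1))) := by
  refine ⟨fun N x h0 h => MixedProblem.le_of_isFullRotShift_sequence h0 h, ?_⟩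
  intro xmin hmin y hy
  obtain ⟨N, z, hN, h0, hN', hst, hrot⟩ := MixedProblem.StablePair.exists_sequence
    ⟨hmin.1, hy, (MixedProblem.prefersW_iff hy).1 (hmin.2 y hy)⟩
  exact ⟨N, z, by omega, h0, hN', hst, hrot⟩
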